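/- Let $n\ge 1$ and consider the system $y'=-Ay+G(y)+f(t)$ in $\mathbb C^n$, where $A$ is a complex $n\times n$ matrix all of whose eigenvalues have positive real parts, and $G:\mathbb C^n\to\mathbb C^n$ is locally Lipschitz. Suppose there are homogeneous polynomials $G_m:\mathbb C^n\to\mathbb C^n$ of degree $m$, $m\ge 2$, such that for every $N\ge 2$ there is $\delta>0$ with $|G(x)-\sum_{m=2}^N G_m(x)|=\mathcal O(|x|^{N+\delta})$ as $x\to0$. For $\mu\in\mathbb R$ let $\mathcal F_E(\mu,\mathbb C^n)$ be the set of functions $g:\mathbb R\to\mathbb C^n$ of the form $g(t)=\sum_{\lambda\in S}p_\lambda(t)e^{\lambda t}$, where $S\subset\mathbb C$ is finite, $\operatorname{Re}\lambda=\mu$ for all $\lambda\in S$, and each $p_\lambda$ is a polynomial from $\mathbb R$ to $\mathbb C^n$. For a strictly increasing, divergent sequence $(\gamma_k)_{k\ge1}$ of nonnegative numbers and $g_k\in\mathcal F_E(-\gamma_k,\mathbb C^n)$, write $g(t)\sim\sum_{k=1}^\infty g_k(t)$ if for every $N\ge1$ there is $\mu>\gamma_N$ such that $|g(t)-\sum_{k=1}^N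 g_k(t)|=\mathcal O(e^{-\mu t})$ as $t\to\infty$. Let $(\mu_k)_{k\ge1}$ be a divergent, strictly increasing sequence of positive numbers such that the set $\{\mu_k:k\ge 1\}$ is closed under addition and contains the real part of every eigenvalue of $A$. Suppose that $f$ is continuous on $[T_f,\infty)$ for some $T_f\ge0$ and that $f(t)\sim\sum_{k=1}^\infty f_k(t)$ with $f_k\in\mathcal F_E(-\mu_k,\mathbb C^n)$. Let $y\in C^1((T_0,\infty))$, $T_0\ge0$, be a solution of the system on $(T_0,\infty)$ with $y(t)\to0$ as $t\to\infty$. Then there exist $m$-linear maps $\mathcal G_m:(\mathbb C^n)^m\to\mathbb C^n$, $m\ge2$, with $G_m(x)=\mathcal G_m(x,\dots,x)$ for all $x$, and for every choice of such maps there exist functions $y_k\in\mathcal F_E(-\mu_k,\mathbb C^n)$, $k\ge1$, such that $y(t)\sim\sum_{k=1}^\infty y_k(t)$ and, for every $k\ge1$, $$y_k'+Ay_k=\sum_{m\ge2}\ \sum_{\mu_{j_1}+\cdots+\mu_{j_m}=\mu_k}\mathcal G_m(y_{j_1},\dots,y_{j_m})+f_k\quad\text{on }\mathbb R,$$ where the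 (finite) inner sums run over all $(j_1,\dots,j_m)\in\mathbb N^m$ satisfying the stated condition, $\mathbb N=\{1,2,\dots\}$. -/

import Mathlib

open Filter Topology Asymptotics

namespace ExpExpansion

/-- A polynomial map from `ℝ` to a complex linear space `X`:
`p(t) = ∑_{j ≤ d} t ^ j a_j` with coefficients `a_j ∈ X`. -/
def IsPolynomialMap {X : Type*} [AddCommGroup X] [Module ℂ X] (p : ℝ → X) : Prop :=
  ∃ (d : ℕ) (a : ℕ → X), ∀ t : ℝ, p t = ∑ j ∈ Finset.range (d + 1), ((t : ℂ) ^ j) • a j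

/-- The class `𝓕_E(μ, X)`: functions `g(t) = ∑_{z ∈ S} p_z(t) e^{z t}` on `ℝ`, where `S ⊂ ℂ` is a
finite set with `Re z = μ` for all `z ∈ S`, and each `p_z` is a polynomial from `ℝ` to `X`. -/
def FE (μ : ℝ) (X : Type*) [AddCommGroup X] [Module ℂ X] : Set (ℝ → X) :=
  {g | ∃ (S : Finset ℂ) (p : ℂ → ℝ → X),
      (∀ z ∈ S, z.re = μ) ∧ (∀ z ∈ S, IsPolynomialMap (p z)) ∧
      ∀ t : ℝ, g t = ∑ z ∈ S, Complex.exp (z * t) • p z t}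

/-- The expansion `g(t) ∼ ∑_k g_k(t)` with `g_k ∈ 𝓕_E(-γ_k, X)`: for every `N` there is `μ > γ_N`
with `‖g(t) - ∑_{k ≤ N} g_k(t)‖ = O(e^{-μ t})` as `t → ∞`.
Sequences are indexed from `0`: the entry with index `k` is the `(k+1)`-st term. -/
def HasExpansion {X : Type*} [NormedAddCommGroup X] [NormedSpace ℂ X]
    (g : ℝ → X) (γ : ℕ → ℝ) (gs : ℕ → ℝ → X) : Prop :=
  (∀ k, gs k ∈ FE (-γ k) X) ∧
  ∀ N : ℕ, ∃ μ : ℝ, γ N < μ ∧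
    (fun t : ℝ => g t - ∑ k ∈ Finset.range (N + 1), gs k t) =O[atTop]
      fun t : ℝ => Real.exp (-μ * t)

/-- `P : ℂⁿ → ℂⁿ` is a homogeneous polynomial (in the complex coordinates) of degree `m`. -/
def IsHomogeneousPolynomialMap {n : ℕ} (m : ℕ)
    (P : EuclideanSpace ℂ (Fin n) → EuclideanSpace ℂ (Fin n)) : Prop :=
  ∃ q : Fin n → MvPolynomial (Fin n) ℂ, (∀ i, (q i).IsHomogeneous m) ∧
    ∀ x i, P x i = MvPolynomial.eval (fun j => x j) (q i)

/-- The formal Taylor expansion `G(x) ∼ ∑_{m ≥ 2} G_m(x)` as `x → 0`: each `G_m` is a homogeneous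
polynomial of degree `m`, and for every `N ≥ 2` there is `δ > 0` with
`|G(x) - ∑_{m=2}^N G_m(x)| = O(|x|^{N+δ})` as `x → 0`. -/
def HasFormalTaylorExpansion {n : ℕ}
    (G : EuclideanSpace ℂ (Fin n) → EuclideanSpace ℂ (Fin n))
    (Gs : ℕ → EuclideanSpace ℂ (Fin n) → EuclideanSpace ℂ (Fin n)) : Prop :=
  (∀ m, 2 ≤ m → IsHomogeneousPolynomialMap m (Gs m)) ∧
  ∀ N : ℕ, 2 ≤ N → ∃ δ : ℝ, 0 < δ ∧
    (fun x => G x - ∑ m ∈ Finset.Icc 2 N, Gs m x) =O[𝓝 0] fun x => ‖x‖ ^ ((N : ℝ) + δ)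

/-- `L_m`, for `m ≥ 2`, are `m`-linear maps `(ℂⁿ)^m → ℂⁿ` with `G_m(x) = L_m(x, …, x)`. -/
def ArePolarizations {n : ℕ}
    (Gs : ℕ → EuclideanSpace ℂ (Fin n) → EuclideanSpace ℂ (Fin n))
    (L : ∀ m : ℕ, MultilinearMap ℂ (fun _ : Fin m => EuclideanSpace ℂ (Fin n))
      (EuclideanSpace ℂ (Fin n))) : Prop :=
  ∀ m, 2 ≤ m → ∀ x, Gs m x = L m (fun _ => x)

/-- The index set of the double sum
`∑_{m ≥ 2} ∑_{μ_{j_1} + ⋯ + μ_{j_m} = μ_k}`: all pairs `(m, (j_1, …, j_m))` with `m ≥ 2`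
and `μ_{j_1} + ⋯ + μ_{j_m} = μ_k`. -/
def sumIndex (μ : ℕ → ℝ) (k : ℕ) : Set (Σ m : ℕ, Fin m → ℕ) :=
  {q | 2 ≤ q.1 ∧ ∑ l, μ (q.2 l) = μ k}

/-- The double sum `∑_{m ≥ 2} ∑_{μ_{j_1} + ⋯ + μ_{j_m} = μ_k} L_m(y_{j_1}(t), …, y_{j_m}(t))`.
By `sumIndex_finite` below it is a sum over a finite index set for the sequences in question. -/
noncomputable def nonlinearTerm {n : ℕ} (μ : ℕ → ℝ)
    (L : ∀ m : ℕ, MultilinearMap ℂ (fun _ : Fin m => EuclideanSpace ℂ (Fin n))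
      (EuclideanSpace ℂ (Fin n)))
    (ys : ℕ → ℝ → EuclideanSpace ℂ (Fin n)) (k : ℕ) (t : ℝ) : EuclideanSpace ℂ (Fin n) :=
  ∑ᶠ q ∈ sumIndex μ k, L q.1 (fun l => ys (q.2 l) t)

theorem sumIndex_finite {μ : ℕ → ℝ} (hpos : ∀ k, 0 < μ k) (hmono : StrictMono μ) (k : ℕ) :
    (sumIndex μ k).Finite := by
  obtain ⟨M, hM⟩ := exists_nat_gt (μ k / μ 0)
  have hfin : (⋃ m ∈ Finset.range (M + 1), (Sigma.mk m) ''
      (Fintype.piFinset (fun _ : Fin m => Finset.range (k + 1)) : Set (Fin m → ℕ))).Finite := by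
    refine Set.Finite.biUnion (Finset.finite_toSet _) fun m _ => ?_
    exact (Finset.finite_toSet _).image _
  refine hfin.subset ?_
  rintro ⟨m, j⟩ ⟨_, hs⟩
  simp only at hs
  have h1 : (m : ℝ) * μ 0 ≤ μ k := by
    rw [← hs]
    have := Finset.card_nsmul_le_sum Finset.univ (fun l => μ (j l)) (μ 0)
      (fun l _ => hmono.monotone (Nat.zero_le _))
    simpa using this
  have hm : m < M := by
    have h2 : (m : ℝ) ≤ μ k / μ 0 := (le_div_iff₀ (hpos 0)).2 h1
    exact_mod_cast lt_of_le_of_lt h2 hM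
  have hj : ∀ l, j l ≤ k := by
    intro l
    have h3 : μ (j l) ≤ μ k := by
      rw [← hs]
      exact Finset.single_le_sum (f := fun l => μ (j l)) (fun i _ => (hpos _).le)
        (Finset.mem_univ l)
    exact hmono.le_iff_le.1 h3
  simp only [Set.mem_iUnion]
  refine ⟨m, Finset.mem_range.2 (by omega), j, ?_, rfl⟩
  simp only [Finset.mem_coe, Fintype.mem_piFinset, Finset.mem_range]
  exact fun l => Nat.lt_succ_of_le (hj l)

end ExpExpansion

/-!
The terms `y_k` are constructed one after the other. Let `Y = ∑_{k < N} y_k` approximate the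
solution up to `w = y - Y = O(e^{-μ' t})`, where `μ'` exceeds the exponents already treated. Insert
`y = Y + w` into the Taylor polynomials of `G` and expand by multilinearity. Exponents add up
(`FE.multilinear`), and since the set of exponents is closed under addition, the products of terms
of `Y` of exponent at most `μ_N` are exactly the nonlinear terms of the equations for
`y_0, …, y_N` (`sum_nonlinearTerm`). All other contributions, namely the products of higher
exponent, the products with a factor `w`, and the Taylor remainder, decay faster than `e^{-μ_N t}`
(`decaysFaster_sub_sum_nonlinearTerm`). Hence `w' = -A w + g + h` with `g ∈ 𝓕_E(-μ_N)` and a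
fast decaying `h`. No eigenvalue of `A` has its real part in `[μ', μ_N)`, so `w` agrees, up to a
fast decaying error, with a solution `y_N ∈ 𝓕_E(-μ_N)` of `p' = -A p + g`
(`exists_FE_asymptotics`), and this is the next term (`exists_next_term`).

The construction starts from `y = O(e^{-α t})` for all `α < μ_0`
(`isBigO_exp_of_tendsto_zero`): the uniform a priori bound `exists_linear_bound` for
`w' = -A w + h` absorbs `G(y) = o(y)`, as `y → 0`.

Both facts about linear systems are proved by induction on the dimension. A left eigenvector of `A`
splits off a scalar equation and leaves a system on its kernel (`exists_splitting`), and scalar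
equations are treated with an integrating factor and the mean value inequality. Thus neither matrix
exponentials nor integrals are needed.
-/

namespace ExpExpansion

/-! ### The classes `𝓕_E` -/

section FE

variable {X : Type*} [AddCommGroup X] [Module ℂ X]

theorem IsPolynomialMap.zero : IsPolynomialMap (0 : ℝ → X) :=
  ⟨0, 0, fun t => by simp⟩

theorem IsPolynomialMap.add {p q : ℝ → X} (hp : IsPolynomialMap p) (hq : IsPolynomialMap q) :
    IsPolynomialMap (p + q) := by
  obtain ⟨d, a, ha⟩ := hp
  obtain ⟨e, b, hb⟩ := hq
  -- pad both coefficient sequences by zeros up to the common degree `d + e`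
  refine ⟨d + e, fun j => (if j < d + 1 then a j else 0) + (if j < e + 1 then b j else 0),
    fun t => ?_⟩
  have key : ∀ (k : ℕ) (c : ℕ → X), k ≤ d + e →
      ∑ j ∈ Finset.range (k + 1), ((t : ℂ) ^ j) • c j =
        ∑ j ∈ Finset.range (d + e + 1), ((t : ℂ) ^ j) • (if j < k + 1 then c j else 0) := by
    intro k c hk
    rw [← Finset.sum_subset (Finset.range_mono (by omega : k + 1 ≤ d + e + 1))]
    · refine Finset.sum_congr rfl fun j hj => ?_
      rw [if_pos (Finset.mem_range.1 hj)]
    · intro j _ hj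
      rw [if_neg (fun h => hj (Finset.mem_range.2 h)), smul_zero]
  simp only [Pi.add_apply, ha, hb, smul_add, Finset.sum_add_distrib]
  rw [key d a (by omega), key e b (by omega)]

theorem FE.zero_mem (μ : ℝ) : (0 : ℝ → X) ∈ FE μ X :=
  ⟨∅, 0, by simp, by simp, by simp⟩

theorem FE.add_mem {μ : ℝ} {g h : ℝ → X} (hg : g ∈ FE μ X) (hh : h ∈ FE μ X) :
    g + h ∈ FE μ X := by
  obtain ⟨S, p, hS, hp, hgp⟩ := hg
  obtain ⟨R, q, hR, hq, hhq⟩ := hh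
  refine ⟨S ∪ R, fun z => (if z ∈ S then p z else 0) + (if z ∈ R then q z else 0), ?_, ?_, ?_⟩
  · intro z hz
    rcases Finset.mem_union.1 hz with h | h
    exacts [hS z h, hR z h]
  · intro z _
    refine IsPolynomialMap.add ?_ ?_
    · split_ifs with h
      exacts [hp z h, IsPolynomialMap.zero]
    · split_ifs with h
      exacts [hq z h, IsPolynomialMap.zero]
  · intro t
    have key : ∀ (U : Finset ℂ) (r : ℂ → ℝ → X), U ⊆ S ∪ R →
        ∑ z ∈ U, Complex.exp (z * t) • r z t =
          ∑ z ∈ S ∪ R, Complex.exp (z * t) • (if z ∈ U then r z else 0) t := by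
      intro U r hU
      rw [← Finset.sum_subset hU]
      · exact Finset.sum_congr rfl fun z hz => by rw [if_pos hz]
      · intro z _ hz
        rw [if_neg hz, Pi.zero_apply, smul_zero]
    simp only [Pi.add_apply, hgp, hhq, smul_add, Finset.sum_add_distrib]
    rw [key S p Finset.subset_union_left, key R q Finset.subset_union_right]

theorem FE.sum_mem {ι : Type*} {μ : ℝ} (s : Finset ι) {g : ι → ℝ → X}
    (hg : ∀ i ∈ s, g i ∈ FE μ X) : (fun t => ∑ i ∈ s, g i t) ∈ FE μ X := by
  classical
  induction s using Finset.induction_on with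
  | empty => exact FE.zero_mem μ
  | insert i s hi ih =>
    have h := FE.add_mem (hg i (Finset.mem_insert_self i s))
      (ih fun j hj => hg j (Finset.mem_insert_of_mem hj))
    convert h using 1
    funext t
    simp [Finset.sum_insert hi]

theorem FE.monomial_mem {μ : ℝ} {z : ℂ} (hz : z.re = μ) (j : ℕ) (v : X) :
    (fun t : ℝ => ((t : ℂ) ^ j * Complex.exp (z * t)) • v) ∈ FE μ X := by
  refine ⟨{z}, fun _ t => ((t : ℂ) ^ j) • v, by simpa using hz, fun _ _ => ?_, fun t => ?_⟩
  · refine ⟨j, fun i => if i = j then v else 0, fun t => ?_⟩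
    simp [Finset.sum_ite_eq']
  · simp [smul_smul, mul_comm]

/-- An element of `𝓕_E` is a finite sum of functions `t ^ j e^{z t} v`. -/
theorem FE.exists_monomials {μ : ℝ} {g : ℝ → X} (hg : g ∈ FE μ X) :
    ∃ (s : Finset (Σ _ : ℂ, ℕ)) (v : (Σ _ : ℂ, ℕ) → X), (∀ q ∈ s, q.1.re = μ) ∧
      ∀ t : ℝ, g t = ∑ q ∈ s, ((t : ℂ) ^ q.2 * Complex.exp (q.1 * t)) • v q := by
  obtain ⟨S, p, hS, hp, hgp⟩ := hg
  choose! d a ha using hp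
  refine ⟨S.sigma fun z => Finset.range (d z + 1), fun q => a q.1 q.2, ?_, fun t => ?_⟩
  · intro q hq
    exact hS _ (Finset.mem_sigma.1 hq).1
  · rw [hgp, Finset.sum_sigma]
    refine Finset.sum_congr rfl fun z hz => ?_
    rw [ha z hz, Finset.smul_sum]
    refine Finset.sum_congr rfl fun j _ => ?_
    rw [smul_smul, mul_comm]

theorem FE.map {Y : Type*} [AddCommGroup Y] [Module ℂ Y] {μ : ℝ} {g : ℝ → X}
    (hg : g ∈ FE μ X) (B : X →ₗ[ℂ] Y) : (fun t => B (g t)) ∈ FE μ Y := by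
  obtain ⟨s, v, hs, hv⟩ := FE.exists_monomials hg
  simp only [hv, map_sum, map_smul]
  exact FE.sum_mem s fun q hq => FE.monomial_mem (hs q hq) _ _

/-- Inserting elements of `𝓕_E` into a multilinear map adds up the exponents. -/
theorem FE.multilinear {Y : Type*} [AddCommGroup Y] [Module ℂ Y] {m : ℕ} {γ : Fin m → ℝ}
    {g : Fin m → ℝ → X} (hg : ∀ l, g l ∈ FE (γ l) X)
    (L : MultilinearMap ℂ (fun _ : Fin m => X) Y) :
    (fun t => L fun l => g l t) ∈ FE (∑ l, γ l) Y := by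
  classical
  choose s v hs hv using fun l => FE.exists_monomials (hg l)
  simp only [hv, MultilinearMap.map_sum_finset, MultilinearMap.map_smul_univ]
  refine FE.sum_mem _ fun r hr => ?_
  rw [Fintype.mem_piFinset] at hr
  have hz : (∑ l, (r l).1).re = ∑ l, γ l := by
    rw [Complex.re_sum]
    exact Finset.sum_congr rfl fun l _ => hs l _ (hr l)
  convert FE.monomial_mem hz (∑ l, (r l).2) (L fun l => v l (r l)) using 3 with t
  rw [Finset.prod_mul_distrib, Finset.prod_pow_eq_pow_sum, Finset.sum_mul, Complex.exp_sum]

end FE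

theorem FE.isBigO {X : Type*} [NormedAddCommGroup X] [NormedSpace ℂ X] {μ ν : ℝ} (hμν : μ < ν)
    {g : ℝ → X} (hg : g ∈ FE μ X) : g =O[atTop] fun t => Real.exp (ν * t) := by
  obtain ⟨s, v, hs, hv⟩ := FE.exists_monomials hg
  rw [show g = fun t : ℝ => ∑ q ∈ s, ((t : ℂ) ^ q.2 * Complex.exp (q.1 * t)) • v q from funext hv]
  refine IsBigO.fun_sum fun q hq => ?_
  have h1 : (fun t : ℝ => t ^ q.2) =O[atTop] fun t => Real.exp ((ν - μ) * t) :=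
    (isLittleO_pow_exp_pos_mul_atTop q.2 (sub_pos.2 hμν)).isBigO
  have h2 := (h1.mul (isBigO_refl (fun t => Real.exp (μ * t)) atTop)).norm_left
  have h3 : (fun t : ℝ => ((t : ℂ) ^ q.2 * Complex.exp (q.1 * t)) • v q) =O[atTop]
      fun t => ‖t ^ q.2 * Real.exp (μ * t)‖ := by
    refine IsBigO.of_bound ‖v q‖ (Eventually.of_forall fun t => le_of_eq ?_)
    rw [norm_smul, norm_norm, norm_mul, norm_mul, Complex.norm_exp, norm_pow, norm_pow,
      Complex.norm_real, Complex.re_mul_ofReal, hs q hq, Real.norm_of_nonneg (Real.exp_pos _).le,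
      mul_comm]
  refine h3.trans (h2.congr_right fun t => ?_)
  rw [← Real.exp_add]
  ring_nf

theorem hasDerivAt_cexp_mul_real (a : ℂ) (t : ℝ) :
    HasDerivAt (fun t : ℝ => Complex.exp (a * t)) (a * Complex.exp (a * t)) t := by
  have h : HasDerivAt (fun s : ℂ => Complex.exp (a * s)) (a * Complex.exp (a * t)) t := by
    simpa [mul_comm] using ((hasDerivAt_id (t : ℂ)).const_mul a).cexp
  exact h.comp_ofReal

/-- The scalar equation `p' = -a p + t ^ j e^{z t}` has a solution in `𝓕_E(Re z, ℂ)`. -/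
theorem FE.exists_solution_monomial (a z : ℂ) (j : ℕ) :
    ∃ p ∈ FE z.re ℂ, ∀ t : ℝ,
      HasDerivAt p (-(a * p t) + (t : ℂ) ^ j * Complex.exp (z * t)) t := by
  have hpow : ∀ (k : ℕ) (t : ℝ), HasDerivAt (fun t : ℝ => (t : ℂ) ^ k) (k * (t : ℂ) ^ (k - 1)) t :=
    fun k t => (hasDerivAt_pow k (t : ℂ)).comp_ofReal
  have hmem : ∀ (k : ℕ) (c : ℂ),
      (fun t : ℝ => c * ((t : ℂ) ^ k * Complex.exp (z * t))) ∈ FE z.re ℂ := by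
    intro k c
    simpa [mul_comm] using FE.monomial_mem (rfl : z.re = z.re) k c
  by_cases hza : z = -a
  · -- resonance: the degree of the polynomial goes up by one
    refine ⟨_, hmem (j + 1) ((j + 1 : ℂ)⁻¹), fun t => ?_⟩
    have hj : (j + 1 : ℂ) ≠ 0 := Nat.cast_add_one_ne_zero j
    refine (((hpow (j + 1) t).mul (hasDerivAt_cexp_mul_real z t)).const_mul
      ((j + 1 : ℂ)⁻¹)).congr_deriv ?_
    simp only [Nat.add_sub_cancel]
    push_cast
    subst hza
    field_simp
    ring
  · have hne : z + a ≠ 0 := fun h => hza (eq_neg_of_add_eq_zero_left h)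
    induction j with
    | zero =>
      refine ⟨_, hmem 0 (z + a)⁻¹, fun t => ?_⟩
      refine (((hpow 0 t).mul (hasDerivAt_cexp_mul_real z t)).const_mul ((z + a)⁻¹)).congr_deriv ?_
      simp only [pow_zero, one_mul, Nat.cast_zero, zero_mul, zero_add]
      field_simp
      ring
    | succ k ih =>
      obtain ⟨p, hp, hpd⟩ := ih
      refine ⟨_, FE.add_mem (hmem (k + 1) (z + a)⁻¹)
        (FE.map hp (LinearMap.mulLeft ℂ (-((k + 1 : ℂ) * (z + a)⁻¹)))), fun t => ?_⟩
      refine ((((hpow (k + 1) t).mul (hasDerivAt_cexp_mul_real z t)).const_mul ((z + a)⁻¹)).add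
        ((hpd t).const_mul (-((k + 1 : ℂ) * (z + a)⁻¹)))).congr_deriv ?_
      simp only [Nat.add_sub_cancel, Pi.add_apply, LinearMap.mulLeft_apply]
      push_cast
      field_simp
      ring

theorem FE.exists_solution_scalar {μ : ℝ} (a : ℂ) {g : ℝ → ℂ} (hg : g ∈ FE μ ℂ) :
    ∃ p ∈ FE μ ℂ, ∀ t : ℝ, HasDerivAt p (-(a * p t) + g t) t := by
  obtain ⟨s, v, hs, hv⟩ := FE.exists_monomials hg
  choose p hp hpd using fun q : Σ _ : ℂ, ℕ => FE.exists_solution_monomial a q.1 q.2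
  refine ⟨fun t => ∑ q ∈ s, v q * p q t, FE.sum_mem s fun q hq => ?_, fun t => ?_⟩
  · exact FE.map (hs q hq ▸ hp q) (LinearMap.mulLeft ℂ (v q))
  · refine (HasDerivAt.fun_sum fun q (_ : q ∈ s) => (hpd q t).const_mul (v q)).congr_deriv ?_
    rw [hv, Finset.mul_sum, ← Finset.sum_neg_distrib, ← Finset.sum_add_distrib]
    refine Finset.sum_congr rfl fun q _ => ?_
    rw [smul_eq_mul]
    ring

/-! ### Decay faster than a given exponential rate -/

/-- `DecaysFaster γ h`: the function `h` is `O(e^{-ν t})` as `t → ∞` for some `ν > γ`. -/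
def DecaysFaster {X : Type*} [NormedAddCommGroup X] (γ : ℝ) (h : ℝ → X) : Prop :=
  ∃ ν : ℝ, γ < ν ∧ h =O[atTop] fun t : ℝ => Real.exp (-ν * t)

theorem isBigO_exp_neg_of_le {ν ν' : ℝ} (h : ν ≤ ν') :
    (fun t : ℝ => Real.exp (-ν' * t)) =O[atTop] fun t => Real.exp (-ν * t) := by
  refine IsBigO.of_bound 1 ?_
  filter_upwards [eventually_ge_atTop 0] with t ht
  rw [Real.norm_of_nonneg (Real.exp_pos _).le, Real.norm_of_nonneg (Real.exp_pos _).le, one_mul]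
  exact Real.exp_le_exp.2 (by nlinarith)

namespace DecaysFaster

variable {X : Type*} [NormedAddCommGroup X] {γ : ℝ} {g h : ℝ → X}

theorem add (hg : DecaysFaster γ g) (hh : DecaysFaster γ h) :
    DecaysFaster γ (fun t => g t + h t) := by
  obtain ⟨ν, hν, h1⟩ := hg
  obtain ⟨ν', hν', h2⟩ := hh
  exact ⟨min ν ν', lt_min hν hν', (h1.trans (isBigO_exp_neg_of_le (min_le_left _ _))).add
    (h2.trans (isBigO_exp_neg_of_le (min_le_right _ _)))⟩

theorem sum {ι : Type*} (s : Finset ι) {u : ι → ℝ → X} (hu : ∀ i ∈ s, DecaysFaster γ (u i)) :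
    DecaysFaster γ (fun t => ∑ i ∈ s, u i t) := by
  classical
  induction s using Finset.induction_on with
  | empty =>
    refine ⟨γ + 1, by linarith, ?_⟩
    simpa using isBigO_zero (E' := X) (fun t : ℝ => Real.exp (-(γ + 1) * t)) atTop
  | insert i s hi ih =>
    simp only [Finset.sum_insert hi]
    exact (hu i (Finset.mem_insert_self i s)).add
      (ih fun j hj => hu j (Finset.mem_insert_of_mem hj))

theorem of_isBigO {Y : Type*} [NormedAddCommGroup Y] {u : ℝ → Y} (hh : DecaysFaster γ h)
    (huh : u =O[atTop] h) : DecaysFaster γ u := by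
  obtain ⟨ν, hν, h1⟩ := hh
  exact ⟨ν, hν, huh.trans h1⟩

theorem congr' (hh : DecaysFaster γ h) (hgh : g =ᶠ[atTop] h) : DecaysFaster γ g :=
  hh.of_isBigO hgh.isBigO

theorem sub (hg : DecaysFaster γ g) (hh : DecaysFaster γ h) :
    DecaysFaster γ (fun t => g t - h t) := by
  simpa [sub_eq_add_neg] using hg.add (hh.of_isBigO (u := fun t => -h t) (isBigO_refl h _).neg_left)

theorem of_mem_FE [NormedSpace ℂ X] {ν : ℝ} (hν : γ < ν) (hg : g ∈ FE (-ν) X) :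
    DecaysFaster γ g :=
  ⟨(γ + ν) / 2, by linarith, FE.isBigO (by linarith) hg⟩

end DecaysFaster

/-! ### Linear systems: splitting off a left eigenvector -/

/-- An operator `A` on a nonzero finite-dimensional complex space `V` has a left eigenvector `φ`,
`φ ∘ A = a φ`. Normalizing by `φ v = 1` and projecting along `v` onto `W = ker φ` gives
`x = P x + φ(x) v` and `P A = A' P + φ(·) P A v` with an operator `A'` on the smaller space `W`, all
of whose eigenvalues are eigenvalues of `A`. It carries inductions on the dimension of `V`, which
replace triangularization. -/
theorem exists_splitting {V : Type*} [NormedAddCommGroup V] [NormedSpace ℂ V]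
    [FiniteDimensional ℂ V] [Nontrivial V] (A : Module.End ℂ V) :
    ∃ (W : Submodule ℂ V) (P : V →L[ℂ] W) (φ : V →L[ℂ] ℂ) (v : V) (A' : Module.End ℂ W) (a : ℂ),
      Module.finrank ℂ W < Module.finrank ℂ V ∧ A.HasEigenvalue a ∧
      (∀ z, A'.HasEigenvalue z → A.HasEigenvalue z) ∧
      (∀ x, φ (A x) = a * φ x) ∧ (∀ x, P (A x) = A' (P x) + φ x • P (A v)) ∧
      (∀ x, x = (P x : V) + φ x • v) ∧ (∀ x : W, A x = (A' x : V)) ∧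
      A v = (P (A v) : V) + a • v := by
  obtain ⟨a, ha⟩ := Module.End.exists_eigenvalue (K := ℂ) (V := Module.Dual ℂ V)
    (Module.Dual.transpose A)
  obtain ⟨φ, hφ⟩ := ha.exists_hasEigenvector
  have hφA : ∀ x, φ (A x) = a * φ x := fun x =>
    LinearMap.congr_fun hφ.apply_eq_smul x
  obtain ⟨u, hu⟩ : ∃ u, φ u ≠ 0 := by
    by_contra! h
    exact hφ.2 (LinearMap.ext h)
  obtain ⟨v, hv⟩ : ∃ v, φ v = 1 := ⟨(φ u)⁻¹ • u, by simp [hu]⟩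
  -- `φ` vanishes on the range of `A - a`, so `A - a` is not surjective, hence not injective
  have haA : A.HasEigenvalue a := by
    rw [Module.End.hasEigenvalue_iff, Module.End.eigenspace_def]
    intro hker
    have hsurj := LinearMap.injective_iff_surjective.1 (LinearMap.ker_eq_bot.1 hker)
    obtain ⟨x, hx⟩ := hsurj v
    have h0 : φ ((A - a • (1 : Module.End ℂ V)) x) = 0 := by simp [hφA]
    rw [hx, hv] at h0
    exact one_ne_zero h0
  let P₀ : V →ₗ[ℂ] LinearMap.ker φ :=
    LinearMap.codRestrict (LinearMap.ker φ) (LinearMap.id - φ.smulRight v) fun x => by simp [hv]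
  have hP₀ : ∀ x, (P₀ x : V) = x - φ x • v := fun x => rfl
  refine ⟨LinearMap.ker φ, P₀.toContinuousLinearMap, φ.toContinuousLinearMap, v,
    P₀ ∘ₗ A ∘ₗ (LinearMap.ker φ).subtype, a, ?_, haA, ?_, hφA, ?_, ?_, ?_, ?_⟩
  · refine Submodule.finrank_lt fun htop => hu ?_
    exact LinearMap.mem_ker.1 (htop ▸ Submodule.mem_top)
  · intro z hz
    obtain ⟨x, hx⟩ := hz.exists_hasEigenvector
    refine Module.End.hasEigenvalue_of_hasEigenvector (x := (x : V))
      ⟨?_, fun h => hx.2 (by simpa using h)⟩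
    rw [Module.End.mem_eigenspace_iff]
    have h1 := congrArg Subtype.val hx.apply_eq_smul
    have h2 : φ x = 0 := x.2
    simpa [hP₀, hφA, h2] using h1
  · intro x
    have h : x = (P₀ x : V) + φ x • v := by rw [hP₀]; abel
    change P₀ (A x) = P₀ (A (P₀ x : V)) + φ x • P₀ (A v)
    conv_lhs => rw [h]
    simp only [map_add, map_smul]
  · intro x
    change x = (P₀ x : V) + φ x • v
    rw [hP₀]; abel
  · intro x
    change A x = (P₀ (A x) : V)
    have hx : φ x = 0 := x.2
    rw [hP₀, hφA, hx, mul_zero, zero_smul, sub_zero]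
  · change A v = (P₀ (A v) : V) + a • v
    rw [hP₀, hφA, hv, mul_one, sub_add_cancel]

theorem hasDerivAt_clm_comp {V W : Type*} [NormedAddCommGroup V] [NormedSpace ℂ V]
    [NormedAddCommGroup W] [NormedSpace ℂ W] (B : V →L[ℂ] W) {w : ℝ → V} {w' : V} {t : ℝ}
    (h : HasDerivAt w w' t) : HasDerivAt (fun s => B (w s)) (B w') t :=
  ((B.restrictScalars ℝ).hasFDerivAt (x := w t)).comp_hasDerivAt t h

/-- Multiplying by the integrating factor `e^{a t}` removes the linear part of
`w' = -a w + h`. -/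
theorem hasDerivAt_integrating_factor {a : ℂ} {w h : ℝ → ℂ} {t : ℝ}
    (hw : HasDerivAt w (-(a * w t) + h t) t) :
    HasDerivAt (fun s : ℝ => Complex.exp (a * s) * w s) (Complex.exp (a * t) * h t) t :=
  ((hasDerivAt_cexp_mul_real a t).mul hw).congr_deriv (by ring)

theorem norm_cexp_mul_real (a : ℂ) (t : ℝ) : ‖Complex.exp (a * t)‖ = Real.exp (a.re * t) := by
  rw [Complex.norm_exp, Complex.re_mul_ofReal]

theorem hasDerivAt_exp_mul_div {κ : ℝ} (hκ : κ ≠ 0) (K s : ℝ) :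
    HasDerivAt (fun t => K / κ * Real.exp (κ * t)) (K * Real.exp (κ * s)) s := by
  have h : HasDerivAt (fun t => Real.exp (κ * t)) (κ * Real.exp (κ * s)) s := by
    simpa [mul_comm] using ((hasDerivAt_id s).const_mul κ).exp
  refine (h.const_mul (K / κ)).congr_deriv ?_
  field_simp

theorem norm_sub_le_of_norm_deriv_le_exp {c c' : ℝ → ℂ} {T t K κ : ℝ} (hκ : κ ≠ 0)
    (hc : ∀ s ∈ Set.Icc T t, HasDerivAt c (c' s) s)
    (hb : ∀ s ∈ Set.Icc T t, ‖c' s‖ ≤ K * Real.exp (κ * s)) :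
    ∀ s ∈ Set.Icc T t, ‖c s - c T‖ ≤ K / κ * (Real.exp (κ * s) - Real.exp (κ * T)) := by
  intro s hs
  refine image_norm_le_of_norm_deriv_right_le_deriv_boundary (f := fun s => c s - c T) (f' := c')
    (B := fun s => K / κ * (Real.exp (κ * s) - Real.exp (κ * T)))
    (B' := fun s => K * Real.exp (κ * s)) (a := T) (b := t) ?_ ?_ ?_ ?_ ?_ hs
  · exact fun x hx => ((hc x hx).sub_const _).continuousAt.continuousWithinAt
  · exact fun x hx => ((hc x (Set.Ico_subset_Icc_self hx)).sub_const _).hasDerivWithinAt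
  · simp
  · intro x
    simpa only [mul_sub] using (hasDerivAt_exp_mul_div hκ K x).sub_const _
  · exact fun x hx => hb x (Set.Ico_subset_Icc_self hx)

/-! ### Linear systems: an a priori bound on finite intervals -/

theorem scalar_bound {a : ℂ} {α : ℝ} (ha : α < a.re) {w h : ℝ → ℂ} {T t K : ℝ}
    (hw : ∀ s ∈ Set.Icc T t, HasDerivAt w (-(a * w s) + h s) s)
    (hh : ∀ s ∈ Set.Icc T t, ‖h s‖ ≤ K * Real.exp (-α * s)) :
    ∀ s ∈ Set.Icc T t, ‖w s‖ ≤
      (1 + 1 / (a.re - α)) * (‖w T‖ * Real.exp (α * T) + K) * Real.exp (-α * s) := by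
  intro s hs
  have hκ : 0 < a.re - α := sub_pos.2 ha
  have hTs : T ≤ s := hs.1
  have hT : T ∈ Set.Icc T t := ⟨le_rfl, hTs.trans hs.2⟩
  have hK : 0 ≤ K := by
    have := (norm_nonneg _).trans (hh T hT)
    exact nonneg_of_mul_nonneg_left this (Real.exp_pos _)
  have key := norm_sub_le_of_norm_deriv_le_exp hκ.ne'
    (c := fun s : ℝ => Complex.exp (a * s) * w s) (K := K)
    (fun s hs => hasDerivAt_integrating_factor (hw s hs)) (fun s hs => by
      rw [norm_mul, norm_cexp_mul_real]
      calc Real.exp (a.re * s) * ‖h s‖ ≤ Real.exp (a.re * s) * (K * Real.exp (-α * s)) := by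
            gcongr; exact hh s hs
        _ = K * (Real.exp (a.re * s) * Real.exp (-α * s)) := by ring
        _ = K * Real.exp ((a.re - α) * s) := by rw [← Real.exp_add]; ring_nf) s hs
  have h1 : Real.exp (a.re * s) * ‖w s‖ ≤
      Real.exp (a.re * T) * ‖w T‖ + K / (a.re - α) * Real.exp ((a.re - α) * s) := by
    have h2 := norm_le_norm_add_norm_sub' (Complex.exp (a * s) * w s) (Complex.exp (a * T) * w T)
    rw [norm_mul, norm_mul, norm_cexp_mul_real, norm_cexp_mul_real] at h2
    have h3 : 0 ≤ K / (a.re - α) * Real.exp ((a.re - α) * T) := by positivity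
    rw [mul_sub] at key
    linarith
  have h2 : ‖w s‖ ≤ Real.exp (-(a.re * s)) *
      (Real.exp (a.re * T) * ‖w T‖ + K / (a.re - α) * Real.exp ((a.re - α) * s)) := by
    calc ‖w s‖ = Real.exp (-(a.re * s)) * (Real.exp (a.re * s) * ‖w s‖) := by
          rw [← mul_assoc, ← Real.exp_add]; simp
      _ ≤ _ := by gcongr
  have h3 : Real.exp (-(a.re * s)) * Real.exp (a.re * T) ≤
      Real.exp (α * T) * Real.exp (-α * s) := by
    rw [← Real.exp_add, ← Real.exp_add]
    exact Real.exp_le_exp.2 (by nlinarith)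
  have h4 : Real.exp (-(a.re * s)) * Real.exp ((a.re - α) * s) = Real.exp (-α * s) := by
    rw [← Real.exp_add]; ring_nf
  calc ‖w s‖ ≤ _ := h2
    _ = (Real.exp (-(a.re * s)) * Real.exp (a.re * T)) * ‖w T‖ +
        K / (a.re - α) * (Real.exp (-(a.re * s)) * Real.exp ((a.re - α) * s)) := by ring
    _ ≤ (Real.exp (α * T) * Real.exp (-α * s)) * ‖w T‖ + K / (a.re - α) * Real.exp (-α * s) := by
        rw [h4]; gcongr
    _ ≤ _ := by
        have h5 : 0 ≤ (1 / (a.re - α) * (‖w T‖ * Real.exp (α * T)) + K) * Real.exp (-α * s) := by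
          positivity
        linear_combination h5

/-- Uniform a priori bound: if every eigenvalue of `A` has real part `> α`, then a solution of
`w' = -A w + h` on `[T, t]` with `‖h(s)‖ ≤ K e^{-α s}` satisfies
`‖w(s)‖ ≤ C (‖w(T)‖ e^{α T} + K) e^{-α s}`, where `C` depends on `A` and `α` only. -/
theorem exists_linear_bound {α : ℝ} (d : ℕ) : ∀ (V : Type*) [NormedAddCommGroup V]
    [NormedSpace ℂ V] [FiniteDimensional ℂ V] (A : Module.End ℂ V), Module.finrank ℂ V = d →
    (∀ z, A.HasEigenvalue z → α < z.re) →
    ∃ C : ℝ, 0 ≤ C ∧ ∀ (w h : ℝ → V) (T t K : ℝ),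
      (∀ s ∈ Set.Icc T t, HasDerivAt w (-(A (w s)) + h s) s) →
      (∀ s ∈ Set.Icc T t, ‖h s‖ ≤ K * Real.exp (-α * s)) →
      ∀ s ∈ Set.Icc T t, ‖w s‖ ≤ C * (‖w T‖ * Real.exp (α * T) + K) * Real.exp (-α * s) := by
  induction d using Nat.strong_induction_on with
  | _ d ih =>
  intro V _ _ _ A hd hA
  rcases subsingleton_or_nontrivial V with hV | hV
  · refine ⟨0, le_rfl, fun w h T t K _ _ s _ => ?_⟩
    simp [Subsingleton.elim (w s) 0]
  obtain ⟨W, P, φ, v, A', a, hdim, ha, hA', hφ, hP, hsplit, -, -⟩ := exists_splitting A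
  obtain ⟨C, hC, hCW⟩ := ih _ (hd ▸ hdim) W A' rfl fun z hz => hA z (hA' z hz)
  have hκ : 0 < a.re - α := sub_pos.2 (hA a ha)
  set C₁ := (1 + 1 / (a.re - α)) * ‖φ‖ with hC₁
  have hC₁0 : 0 ≤ C₁ := by positivity
  refine ⟨C * (‖P‖ + C₁ * ‖P (A v)‖) + C₁ * ‖v‖, by positivity, fun w h T t K hw hh s hs => ?_⟩
  have hT : T ∈ Set.Icc T t := ⟨le_rfl, hs.1.trans hs.2⟩
  have hK : 0 ≤ K := by
    have := (norm_nonneg _).trans (hh T hT)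
    exact nonneg_of_mul_nonneg_left this (Real.exp_pos _)
  set E := ‖w T‖ * Real.exp (α * T) + K with hE
  have hE0 : 0 ≤ E := by positivity
  have h1 : ∀ s ∈ Set.Icc T t, ‖φ (w s)‖ ≤ C₁ * E * Real.exp (-α * s) := by
    intro s hs
    have := scalar_bound (hA a ha) (w := fun s => φ (w s)) (h := fun s => φ (h s))
      (K := ‖φ‖ * K) (fun s hs => by
        simpa [hφ] using hasDerivAt_clm_comp φ (hw s hs)) (fun s hs => by
        calc ‖φ (h s)‖ ≤ ‖φ‖ * ‖h s‖ := φ.le_opNorm _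
          _ ≤ ‖φ‖ * (K * Real.exp (-α * s)) := by gcongr; exact hh s hs
          _ = _ := by ring) s hs
    refine this.trans (mul_le_mul_of_nonneg_right ?_ (Real.exp_pos _).le)
    rw [hC₁, hE, mul_assoc]
    refine mul_le_mul_of_nonneg_left ?_ (by positivity)
    rw [mul_add, ← mul_assoc]
    gcongr
    exact φ.le_opNorm _
  have h2 := hCW (fun s => P (w s)) (fun s => -(φ (w s) • P (A v)) + P (h s)) T t
    (C₁ * E * ‖P (A v)‖ + ‖P‖ * K) (fun s hs => by
      refine (hasDerivAt_clm_comp P (hw s hs)).congr_deriv ?_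
      rw [map_add, map_neg, hP]
      abel) (fun s hs => by
      calc ‖-(φ (w s) • P (A v)) + P (h s)‖ ≤ ‖φ (w s)‖ * ‖P (A v)‖ + ‖P‖ * ‖h s‖ := by
            refine (norm_add_le _ _).trans ?_
            rw [norm_neg, norm_smul]
            gcongr
            exact P.le_opNorm _
        _ ≤ (C₁ * E * Real.exp (-α * s)) * ‖P (A v)‖ + ‖P‖ * (K * Real.exp (-α * s)) := by
            gcongr
            exacts [h1 s hs, hh s hs]
        _ = _ := by ring) s hs
  have h3 : ‖P (w T)‖ * Real.exp (α * T) + (C₁ * E * ‖P (A v)‖ + ‖P‖ * K) ≤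
      (‖P‖ + C₁ * ‖P (A v)‖) * E := by
    have : ‖P (w T)‖ * Real.exp (α * T) ≤ ‖P‖ * (‖w T‖ * Real.exp (α * T)) := by
      rw [← mul_assoc]
      gcongr
      exact P.le_opNorm _
    calc _ ≤ ‖P‖ * (‖w T‖ * Real.exp (α * T)) + (C₁ * E * ‖P (A v)‖ + ‖P‖ * K) := by gcongr
      _ = _ := by rw [hE]; ring
  calc ‖w s‖ = ‖(P (w s) : V) + φ (w s) • v‖ := by rw [← hsplit]
    _ ≤ ‖P (w s)‖ + ‖φ (w s)‖ * ‖v‖ := (norm_add_le _ _).trans (by rw [norm_smul]; rfl)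
    _ ≤ C * ((‖P‖ + C₁ * ‖P (A v)‖) * E) * Real.exp (-α * s) +
        (C₁ * E * Real.exp (-α * s)) * ‖v‖ := by
          gcongr
          · refine h2.trans ?_
            gcongr
          · exact h1 s hs
    _ = _ := by ring

/-! ### Linear systems: asymptotics with a forcing term in `𝓕_E` -/

/-- If `c' = O(e^{-κ t})` with `κ > 0`, then `c` converges, with an error `O(e^{-κ t})`. -/
theorem exists_limit_of_deriv_exp_decay {c c' : ℝ → ℂ} {κ : ℝ} (hκ : 0 < κ)
    (hc : ∀ᶠ s in atTop, HasDerivAt c (c' s) s)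
    (hb : c' =O[atTop] fun s => Real.exp (-κ * s)) :
    ∃ l : ℂ, Tendsto c atTop (𝓝 l) ∧ (fun s => c s - l) =O[atTop] fun s => Real.exp (-κ * s) := by
  obtain ⟨K, hK0, hK⟩ := hb.exists_nonneg
  obtain ⟨T, hT⟩ := eventually_atTop.1 (hc.and hK.bound)
  have key : ∀ s t, T ≤ s → s ≤ t → ‖c t - c s‖ ≤ K / κ * Real.exp (-κ * s) := by
    intro s t hs hst
    have := norm_sub_le_of_norm_deriv_le_exp (neg_ne_zero.2 hκ.ne') (c := c) (c' := c') (T := s)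
      (t := t) (K := K) (fun r hr => (hT r (hs.trans hr.1)).1) (fun r hr => by
        simpa using (hT r (hs.trans hr.1)).2) t ⟨hst, le_rfl⟩
    have h0 : 0 ≤ K / κ * Real.exp (-κ * t) := by positivity
    calc _ ≤ _ := this
      _ = K / κ * Real.exp (-κ * s) - K / κ * Real.exp (-κ * t) := by rw [div_neg]; ring
      _ ≤ _ := by linarith
  have hlim : Tendsto (fun s => K / κ * Real.exp (-κ * s)) atTop (𝓝 0) := by
    have : Tendsto (fun s : ℝ => -κ * s) atTop atBot :=
      tendsto_id.const_mul_atTop_of_neg (neg_neg_of_pos hκ)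
    simpa using (Real.tendsto_exp_atBot.comp this).const_mul (K / κ)
  have hcau : Cauchy (map c atTop) := by
    rw [Metric.cauchy_iff]
    refine ⟨inferInstance, fun ε hε => ?_⟩
    obtain ⟨s, hsT, hs⟩ := ((eventually_ge_atTop T).and
      (hlim.eventually (gt_mem_nhds (half_pos hε)))).exists
    refine ⟨c '' Set.Ici s, image_mem_map (Ici_mem_atTop s), ?_⟩
    rintro _ ⟨x, hx, rfl⟩ _ ⟨y, hy, rfl⟩
    have h1 := key s x hsT hx
    have h2 := key s y hsT hy
    calc dist (c x) (c y) ≤ dist (c x) (c s) + dist (c y) (c s) := dist_triangle_right _ _ _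
      _ < ε := by rw [dist_eq_norm, dist_eq_norm]; linarith
  obtain ⟨l, hl⟩ := cauchy_map_iff_exists_tendsto.1 hcau
  refine ⟨l, hl, IsBigO.of_bound (K / κ) ?_⟩
  filter_upwards [eventually_ge_atTop T] with s hs
  rw [Real.norm_of_nonneg (Real.exp_pos _).le, norm_sub_rev]
  exact le_of_tendsto ((hl.sub_const (c s)).norm) (by
    filter_upwards [eventually_ge_atTop s] with t ht using key s t hs ht)

/-- A solution of `w' = -a w + h`, where `h` decays faster than `e^{-μ t}`, agrees up to an error
decaying faster than `e^{-μ t}` with a solution `p ∈ 𝓕_E(-μ)` of the homogeneous equation. If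
`Re a > μ`, or if `Re a` is smaller than a known rate `μ'` of decay of `w`, then `p = 0`. -/
theorem scalar_homogeneous_asymptotics {a : ℂ} {μ μ' : ℝ} (ha : a.re < μ' ∨ μ ≤ a.re)
    {w h : ℝ → ℂ} (hh : DecaysFaster μ h) (hwO : w =O[atTop] fun t => Real.exp (-μ' * t))
    (hw : ∀ᶠ t in atTop, HasDerivAt w (-(a * w t) + h t) t) :
    ∃ p ∈ FE (-μ) ℂ, (∀ t : ℝ, HasDerivAt p (-(a * p t)) t) ∧
      DecaysFaster μ (fun t => w t - p t) := by
  obtain ⟨ν, hν, hhO⟩ := hh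
  have hexpO : ∀ b : ℂ, (fun t : ℝ => Complex.exp (b * t)) =O[atTop]
      fun t : ℝ => Real.exp (b.re * t) :=
    fun b => IsBigO.of_bound 1 (Eventually.of_forall fun t => by
      rw [norm_cexp_mul_real, Real.norm_of_nonneg (Real.exp_pos _).le, one_mul])
  have hzero : ∀ t : ℝ, HasDerivAt (0 : ℝ → ℂ) (-(a * (0 : ℝ → ℂ) t)) t := fun t => by
    simp
  rcases lt_or_ge μ a.re with hμa | hμa
  · obtain ⟨ν', hν', hν'2⟩ := exists_between (lt_min hν hμa)
    obtain ⟨K, hK⟩ := (hhO.trans (isBigO_exp_neg_of_le (hν'2.le.trans (min_le_left _ _)))).bound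
    obtain ⟨T, hT⟩ := eventually_atTop.1 (hw.and hK)
    refine ⟨0, FE.zero_mem _, hzero, ν', hν', ?_⟩
    refine IsBigO.of_bound ((1 + 1 / (a.re - ν')) * (‖w T‖ * Real.exp (ν' * T) + K)) ?_
    filter_upwards [eventually_ge_atTop T] with t ht
    have := scalar_bound (hν'2.trans_le (min_le_right _ _)) (T := T) (t := t) (K := K)
      (fun s hs => (hT s hs.1).1) (fun s hs => by simpa using (hT s hs.1).2) t ⟨ht, le_rfl⟩
    simpa using this
  have hder : ∀ᶠ t : ℝ in atTop, HasDerivAt (fun s : ℝ => Complex.exp (a * s) * w s)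
      (Complex.exp (a * t) * h t) t := hw.mono fun t ht => hasDerivAt_integrating_factor ht
  obtain ⟨l, hl, hlO⟩ := exists_limit_of_deriv_exp_decay
    (sub_pos.2 (hμa.trans_lt hν)) hder (((hexpO a).mul hhO).congr_right fun t => by
      rw [← Real.exp_add]; ring_nf)
  have hdec : DecaysFaster μ (fun t => w t - l * Complex.exp (-a * t)) := by
    refine ⟨ν, hν, ?_⟩
    refine ((hexpO (-a)).mul hlO).congr (fun t => ?_) fun t => ?_
    · rw [mul_sub, ← mul_assoc, ← Complex.exp_add, neg_mul, neg_add_cancel, Complex.exp_zero]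
      ring
    · rw [← Real.exp_add, Complex.neg_re]
      ring_nf
  rcases hμa.eq_or_lt with hμa | hμa
  · refine ⟨fun t => l * Complex.exp (-a * t), ?_, fun t => ?_, hdec⟩
    · have : (-a).re = -μ := by rw [Complex.neg_re, hμa]
      simpa [mul_comm] using FE.monomial_mem this 0 l
    · exact ((hasDerivAt_cexp_mul_real (-a) t).const_mul l).congr_deriv (by ring)
  · have haμ' : a.re < μ' := ha.resolve_right hμa.not_ge
    -- `e^{a t} w(t) → 0`, so the limit `l` vanishes
    have hl0 : l = 0 := by
      refine tendsto_nhds_unique hl ?_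
      refine IsBigO.trans_tendsto (g'' := fun t => Real.exp ((a.re - μ') * t))
        (((hexpO a).mul hwO).congr_right fun t => ?_) ?_
      · rw [← Real.exp_add]; ring_nf
      · exact Real.tendsto_exp_atBot.comp
          (tendsto_id.const_mul_atTop_of_neg (sub_neg_of_lt haμ'))
    refine ⟨0, FE.zero_mem _, hzero, ?_⟩
    simpa [hl0] using hdec

theorem scalar_asymptotics {a : ℂ} {μ μ' : ℝ} (ha : a.re < μ' ∨ μ ≤ a.re)
    {w g h : ℝ → ℂ} (hg : g ∈ FE (-μ) ℂ) (hh : DecaysFaster μ h)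
    (hwO : w =O[atTop] fun t => Real.exp (-μ' * t))
    (hw : ∀ᶠ t in atTop, HasDerivAt w (-(a * w t) + g t + h t) t) :
    ∃ p ∈ FE (-μ) ℂ, (∀ t : ℝ, HasDerivAt p (-(a * p t) + g t) t) ∧
      DecaysFaster μ (fun t => w t - p t) := by
  obtain ⟨q, hq, hqd⟩ := FE.exists_solution_scalar a hg
  -- subtracting `q ∈ 𝓕_E(-μ)` keeps a rate of decay `μ'' < μ`, still above `Re a` if `Re a < μ'`
  obtain ⟨μ'', h1, h2, h3⟩ : ∃ μ'', μ'' ≤ μ' ∧ μ'' < μ ∧ (a.re < μ'' ∨ μ ≤ a.re) := by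
    rcases lt_or_ge a.re μ with hlt | hge
    · have h4 := ha.resolve_right hlt.not_ge
      exact ⟨min μ' ((a.re + μ) / 2), min_le_left _ _,
        (min_le_right _ _).trans_lt (by linarith), Or.inl (lt_min h4 (by linarith))⟩
    · exact ⟨min μ' (μ - 1), min_le_left _ _, (min_le_right _ _).trans_lt (by linarith),
        Or.inr hge⟩
  obtain ⟨p, hp, hpd, hpw⟩ := scalar_homogeneous_asymptotics h3 (w := fun t => w t - q t) hh
    ((hwO.trans (isBigO_exp_neg_of_le h1)).sub (FE.isBigO (by linarith) hq)) (by
      filter_upwards [hw] with t ht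
      exact (ht.sub (hqd t)).congr_deriv (by ring))
  refine ⟨q + p, FE.add_mem hq hp, fun t => ?_, ?_⟩
  · refine ((hqd t).add (hpd t)).congr_deriv ?_
    rw [Pi.add_apply]
    ring
  · simpa only [Pi.add_apply, sub_sub] using hpw

/-- Let `w' = -A w + g + h` near infinity, where `g ∈ 𝓕_E(-μ)` and `h` decays faster than
`e^{-μ t}`, and let `w = O(e^{-μ' t})`, where no eigenvalue of `A` has real part in `[μ', μ)`. Then
`w` agrees, up to an error decaying faster than `e^{-μ t}`, with a solution `p ∈ 𝓕_E(-μ)` of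
`p' = -A p + g`. -/
theorem exists_FE_asymptotics {μ μ' : ℝ} (d : ℕ) : ∀ (V : Type*) [NormedAddCommGroup V]
    [NormedSpace ℂ V] [FiniteDimensional ℂ V] (A : Module.End ℂ V), Module.finrank ℂ V = d →
    (∀ z, A.HasEigenvalue z → z.re < μ' ∨ μ ≤ z.re) →
    ∀ (w g h : ℝ → V), g ∈ FE (-μ) V → DecaysFaster μ h →
      w =O[atTop] (fun t => Real.exp (-μ' * t)) →
      (∀ᶠ t in atTop, HasDerivAt w (-(A (w t)) + g t + h t) t) →
      ∃ p ∈ FE (-μ) V, (∀ t : ℝ, HasDerivAt p (-(A (p t)) + g t) t) ∧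
        DecaysFaster μ (fun t => w t - p t) := by
  induction d using Nat.strong_induction_on with
  | _ d ih =>
  intro V _ _ _ A hd hA w g h hg hh hwO hw
  rcases subsingleton_or_nontrivial V with hV | hV
  · refine ⟨0, FE.zero_mem _, fun t => ?_, hh.congr' (Eventually.of_forall fun t =>
      Subsingleton.elim _ _)⟩
    exact (hasDerivAt_const t (0 : V)).congr_deriv (Subsingleton.elim _ _)
  obtain ⟨W, P, φ, v, A', a, hdim, ha, hA', hφ, hP, hsplit, hAW, hAv⟩ := exists_splitting A
  obtain ⟨q, hq, hqd, hqw⟩ := scalar_asymptotics (hA a ha) (w := fun t => φ (w t))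
    (FE.map hg φ.toLinearMap) (hh.of_isBigO (φ.isBigO_comp h atTop))
    ((φ.isBigO_comp w atTop).trans hwO) (by
      filter_upwards [hw] with t ht
      refine (hasDerivAt_clm_comp φ ht).congr_deriv ?_
      rw [map_add, map_add, map_neg, hφ]
      rfl)
  -- on the complement, `φ(w)` is replaced by `q`, and the difference joins the remainder
  obtain ⟨r, hr, hrd, hrw⟩ := ih _ (hd ▸ hdim) W A' rfl (fun z hz => hA z (hA' z hz))
    (fun t => P (w t)) (fun t => P (g t) + -(q t • P (A v)))
    (fun t => P (h t) - (φ (w t) - q t) • P (A v))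
    (FE.add_mem (FE.map hg P.toLinearMap)
      (FE.map hq (-(LinearMap.toSpanSingleton ℂ W (P (A v))))))
    ((hh.of_isBigO (P.isBigO_comp h atTop)).sub
      (hqw.of_isBigO (((ContinuousLinearMap.toSpanSingleton ℂ (P (A v))).isBigO_comp _ atTop))))
    ((P.isBigO_comp w atTop).trans hwO) (by
      filter_upwards [hw] with t ht
      refine (hasDerivAt_clm_comp P ht).congr_deriv ?_
      rw [map_add, map_add, map_neg, hP, sub_smul]
      abel)
  refine ⟨fun t => (r t : V) + q t • v, FE.add_mem (FE.map hr W.subtype)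
    (FE.map hq (LinearMap.toSpanSingleton ℂ V v)), fun t => ?_, ?_⟩
  · refine ((hasDerivAt_clm_comp W.subtypeL (hrd t)).add
      (hasDerivAt_clm_comp (ContinuousLinearMap.toSpanSingleton ℂ v) (hqd t))).congr_deriv ?_
    have hA' : A ((r t : V) + q t • v) = (A' (r t) : V) + q t • ((P (A v) : V) + a • v) := by
      rw [map_add, map_smul, hAW, ← hAv]
    rw [hA']
    conv_rhs => rw [hsplit (g t)]
    change -(A' (r t) : V) + ((P (g t) : V) + -(q t • (P (A v) : V))) +
      (-(a * q t) + φ (g t)) • v = _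
    module
  · have h1 := (hrw.of_isBigO (W.subtypeL.isBigO_comp _ atTop)).add
      (hqw.of_isBigO ((ContinuousLinearMap.toSpanSingleton ℂ v).isBigO_comp _ atTop))
    refine h1.congr' (Eventually.of_forall fun t => ?_)
    have h2 := hsplit (w t)
    simp only [map_sub, Submodule.subtypeL_apply, ContinuousLinearMap.toSpanSingleton_apply]
    conv_lhs => rw [h2]
    abel

/-! ### Exponential decay of small solutions -/

/-- A solution of `y' = -A y + F(y) + f` tending to `0`, where `F(x) = o(x)` at `0` and
`f = O(e^{-α t})`, is `O(e^{-α t})` if all eigenvalues of `A` have real part `> α`. -/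
theorem isBigO_exp_of_tendsto_zero {V : Type*} [NormedAddCommGroup V] [NormedSpace ℂ V]
    [FiniteDimensional ℂ V] {A : Module.End ℂ V} {α : ℝ}
    (hA : ∀ z, A.HasEigenvalue z → α < z.re) {F : V → V} (hF : F =o[𝓝 0] fun x => x)
    {f y : ℝ → V} (hf : f =O[atTop] fun t => Real.exp (-α * t))
    (hy0 : Tendsto y atTop (𝓝 0))
    (hy : ∀ᶠ t in atTop, HasDerivAt y (-(A (y t)) + F (y t) + f t) t) :
    y =O[atTop] fun t => Real.exp (-α * t) := by
  obtain ⟨C, hC, hbound⟩ := exists_linear_bound _ V A rfl hA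
  -- `ε` is small enough for `F(y)` to be absorbed in the a priori bound
  set ε := 1 / (2 * (C + 1)) with hε
  have hε0 : 0 < ε := by positivity
  have hCε : C * ε ≤ 1 / 2 := by
    rw [hε, mul_one_div, div_le_div_iff₀ (by positivity) (by norm_num)]
    linarith
  obtain ⟨K, hK⟩ := hf.bound
  obtain ⟨T, hT⟩ := eventually_atTop.1 (hy.and (hK.and (hy0.eventually (hF.def hε0))))
  refine IsBigO.of_bound (2 * C * (‖y T‖ * Real.exp (α * T) + K)) ?_
  filter_upwards [eventually_ge_atTop T] with t ht
  have hcont : ContinuousOn (fun s => ‖y s‖ * Real.exp (α * s)) (Set.Icc T t) := fun s hs =>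
    ((hT s hs.1).1.continuousAt.norm.mul (by fun_prop)).continuousWithinAt
  obtain ⟨s₀, hs₀, hmax⟩ := isCompact_Icc.exists_isMaxOn ⟨t, ht, le_rfl⟩ hcont
  set m := ‖y s₀‖ * Real.exp (α * s₀) with hm
  have hexp : ∀ s : ℝ, Real.exp (α * s) * Real.exp (-α * s) = 1 := fun s => by
    rw [← Real.exp_add]; simp
  have hle : ∀ s ∈ Set.Icc T t, ‖y s‖ ≤ m * Real.exp (-α * s) := by
    intro s hs
    calc ‖y s‖ = (‖y s‖ * Real.exp (α * s)) * Real.exp (-α * s) := by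
          rw [mul_assoc, hexp, mul_one]
      _ ≤ _ := mul_le_mul_of_nonneg_right (hmax hs) (Real.exp_pos _).le
  have h1 := hbound y (fun s => F (y s) + f s) T t (ε * m + K)
    (fun s hs => by simpa only [add_assoc] using (hT s hs.1).1) (fun s hs => by
      have h2 := (hT s hs.1).2.1
      rw [Real.norm_of_nonneg (Real.exp_pos _).le] at h2
      calc ‖F (y s) + f s‖ ≤ ε * ‖y s‖ + K * Real.exp (-α * s) :=
            norm_add_le_of_le (hT s hs.1).2.2 h2
        _ ≤ ε * (m * Real.exp (-α * s)) + K * Real.exp (-α * s) := by gcongr; exact hle s hs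
        _ = _ := by ring) s₀ hs₀
  have h2 : m ≤ C * (‖y T‖ * Real.exp (α * T) + (ε * m + K)) := by
    calc m ≤ (C * (‖y T‖ * Real.exp (α * T) + (ε * m + K)) * Real.exp (-α * s₀)) *
          Real.exp (α * s₀) := mul_le_mul_of_nonneg_right h1 (Real.exp_pos _).le
      _ = _ := by rw [mul_assoc, mul_comm (Real.exp _), hexp, mul_one]
  have hm0 : 0 ≤ m := by positivity
  have h3 : C * ε * m ≤ 1 / 2 * m := mul_le_mul_of_nonneg_right hCε hm0
  have h4 : m ≤ 2 * C * (‖y T‖ * Real.exp (α * T) + K) := by linarith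
  rw [Real.norm_of_nonneg (Real.exp_pos _).le]
  exact (hle t ⟨ht, le_rfl⟩).trans (mul_le_mul_of_nonneg_right h4 (Real.exp_pos _).le)

/-! ### Multilinear maps: existence of polarizations and estimates -/

theorem exists_polarization_monomial {n m : ℕ} (d : Fin n →₀ ℕ) (hd : d.degree = m) :
    ∃ B : MultilinearMap ℂ (fun _ : Fin m => EuclideanSpace ℂ (Fin n)) ℂ,
      ∀ x, B (fun _ => x) = ∏ i, x i ^ d i := by
  -- list the variables of the monomial with repetitions
  obtain ⟨l, hl⟩ := Quot.exists_rep (Finsupp.toMultiset d)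
  have hl' : (l : Multiset (Fin n)) = Finsupp.toMultiset d := hl
  have hlen : l.length = m := by
    rw [← hd, ← Multiset.coe_card, hl', Finsupp.card_toMultiset, Finsupp.degree_eq_sum]
    exact Finsupp.sum_fintype _ _ fun _ => rfl
  subst hlen
  refine ⟨(MultilinearMap.mkPiAlgebra ℂ (Fin l.length) ℂ).compLinearMap
    fun j => (EuclideanSpace.proj (𝕜 := ℂ) (l.get j)).toLinearMap, fun x => ?_⟩
  have h1 : (∏ j, x (l.get j)) = (l.map fun i => x i).prod := by
    rw [← List.prod_ofFn]
    congr 1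
    exact List.ext_get (by simp) (by simp)
  have h2 : (l.map fun i => x i).prod = ∏ i, x i ^ d i := by
    rw [← Multiset.prod_coe, ← Multiset.map_coe, hl', Finsupp.toMultiset_map,
      Finsupp.prod_toMultiset, Finsupp.prod_mapDomain_index (by simp) (by simp [pow_add]),
      Finsupp.prod_fintype _ _ (by simp)]
  exact h1.trans h2

theorem IsHomogeneousPolynomialMap.exists_polarization {n m : ℕ}
    {P : EuclideanSpace ℂ (Fin n) → EuclideanSpace ℂ (Fin n)}
    (hP : IsHomogeneousPolynomialMap m P) :
    ∃ B : MultilinearMap ℂ (fun _ : Fin m => EuclideanSpace ℂ (Fin n))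
      (EuclideanSpace ℂ (Fin n)), ∀ x, P x = B fun _ => x := by
  obtain ⟨q, hq, hP⟩ := hP
  have key : ∀ i, ∃ B : MultilinearMap ℂ (fun _ : Fin m => EuclideanSpace ℂ (Fin n)) ℂ,
      ∀ x, B (fun _ => x) = MvPolynomial.eval (fun j => x j) (q i) := by
    intro i
    have hdeg : ∀ d ∈ (q i).support, d.degree = m := fun d hd => by
      rw [Finsupp.degree_eq_weight_one]
      exact hq i (MvPolynomial.mem_support_iff.1 hd)
    choose! B hB using fun d hd => exists_polarization_monomial d (hdeg d hd)
    refine ⟨∑ d ∈ (q i).support, (q i).coeff d • B d, fun x => ?_⟩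
    rw [MvPolynomial.eval_eq', sum_apply]
    exact Finset.sum_congr rfl fun d hd => by rw [smul_apply, hB d hd, smul_eq_mul]
  choose B hB using key
  refine ⟨(WithLp.linearEquiv 2 ℂ (Fin n → ℂ)).symm.toLinearMap.compMultilinearMap
    (MultilinearMap.pi B), fun x => ?_⟩
  ext i
  rw [hP, ← hB]
  rfl

theorem exists_polarizations {n : ℕ}
    {G : EuclideanSpace ℂ (Fin n) → EuclideanSpace ℂ (Fin n)}
    {Gs : ℕ → EuclideanSpace ℂ (Fin n) → EuclideanSpace ℂ (Fin n)}
    (hG : HasFormalTaylorExpansion G Gs) : ∃ L, ArePolarizations Gs L := by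
  have h : ∀ m, ∃ B : MultilinearMap ℂ (fun _ : Fin m => EuclideanSpace ℂ (Fin n))
      (EuclideanSpace ℂ (Fin n)), 2 ≤ m → ∀ x, Gs m x = B fun _ => x := by
    intro m
    by_cases hm : 2 ≤ m
    · obtain ⟨B, hB⟩ := (hG.1 m hm).exists_polarization
      exact ⟨B, fun _ => hB⟩
    · exact ⟨0, fun h => absurd h hm⟩
  choose L hL using h
  exact ⟨L, hL⟩

theorem exists_multilinear_bound {n m : ℕ} {F : Type*} [NormedAddCommGroup F] [NormedSpace ℂ F]
    (B : MultilinearMap ℂ (fun _ : Fin m => EuclideanSpace ℂ (Fin n)) F) :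
    ∃ C, 0 ≤ C ∧ ∀ v, ‖B v‖ ≤ C * ∏ l, ‖v l‖ := by
  set e := EuclideanSpace.basisFun (Fin n) ℂ
  refine ⟨∑ r : Fin m → Fin n, ‖B fun l => e (r l)‖, by positivity, fun v => ?_⟩
  have hv : v = fun l => ∑ i, v l i • e i := by
    funext l
    simpa [e] using (e.sum_repr (v l)).symm
  conv_lhs => rw [hv]
  rw [MultilinearMap.map_sum, Finset.sum_mul]
  refine norm_sum_le_of_le _ fun r _ => ?_
  rw [MultilinearMap.map_smul_univ, norm_smul, norm_prod, mul_comm]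
  gcongr with l _
  exact PiLp.norm_apply_le (v l) (r l)

theorem isBigO_multilinear_sub {n m : ℕ} (hm : 2 ≤ m)
    (B : MultilinearMap ℂ (fun _ : Fin m => EuclideanSpace ℂ (Fin n)) (EuclideanSpace ℂ (Fin n)))
    {y z : ℝ → EuclideanSpace ℂ (Fin n)} {α β : ℝ} (hα : 0 ≤ α)
    (hy : y =O[atTop] fun t => Real.exp (-α * t)) (hz : z =O[atTop] fun t => Real.exp (-α * t))
    (hyz : (fun t => y t - z t) =O[atTop] fun t => Real.exp (-β * t)) :
    (fun t => B (fun _ => y t) - B fun _ => z t) =O[atTop] fun t => Real.exp (-(α + β) * t) := by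
  obtain ⟨C, hC, hB⟩ := exists_multilinear_bound B
  have h1 : (fun t => B (fun _ => y t) - B fun _ => z t) =O[atTop]
      fun t => (‖y t‖ + ‖z t‖) ^ (m - 1) * ‖y t - z t‖ := by
    refine IsBigO.of_bound (C * m) (Eventually.of_forall fun t => ?_)
    have h2 := B.norm_image_sub_le_of_bound hC hB (fun _ => y t) (fun _ => z t)
    have h3 : ‖(fun _ : Fin m => y t) - fun _ => z t‖ ≤ ‖y t - z t‖ :=
      pi_norm_const_le (y t - z t)
    have h4 : max ‖fun _ : Fin m => y t‖ ‖fun _ : Fin m => z t‖ ≤ ‖y t‖ + ‖z t‖ :=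
      max_le ((pi_norm_const_le _).trans (by linarith [norm_nonneg (z t)]))
        ((pi_norm_const_le _).trans (by linarith [norm_nonneg (y t)]))
    rw [Fintype.card_fin] at h2
    rw [Real.norm_of_nonneg (by positivity), ← mul_assoc]
    refine h2.trans ?_
    gcongr
  have h2 : (fun t => (‖y t‖ + ‖z t‖) ^ (m - 1)) =O[atTop] fun t => Real.exp (-α * t) := by
    refine ((hy.norm_left.add hz.norm_left).pow (m - 1)).trans ?_
    have h3 : (1 : ℝ) ≤ (m - 1 : ℕ) := by
      exact_mod_cast (by omega : 1 ≤ m - 1)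
    refine (isBigO_exp_neg_of_le (ν := α) (ν' := (m - 1 : ℕ) * α) (by nlinarith)).congr_left
      fun t => ?_
    rw [← Real.exp_nat_mul]
    ring_nf
  refine (h1.trans (h2.mul hyz.norm_left)).congr_right fun t => ?_
  rw [← Real.exp_add]
  ring_nf

theorem ArePolarizations.isLittleO {n : ℕ}
    {G : EuclideanSpace ℂ (Fin n) → EuclideanSpace ℂ (Fin n)}
    {Gs : ℕ → EuclideanSpace ℂ (Fin n) → EuclideanSpace ℂ (Fin n)}
    {L : ∀ m : ℕ, MultilinearMap ℂ (fun _ : Fin m => EuclideanSpace ℂ (Fin n))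
      (EuclideanSpace ℂ (Fin n))}
    (hL : ArePolarizations Gs L) (hG : HasFormalTaylorExpansion G Gs) :
    G =o[𝓝 0] fun x => x := by
  obtain ⟨δ, hδ, hO⟩ := hG.2 2 le_rfl
  obtain ⟨C, hC, hB⟩ := exists_multilinear_bound (L 2)
  have hnorm : Tendsto (fun x : EuclideanSpace ℂ (Fin n) => ‖x‖) (𝓝 0) (𝓝 0) :=
    tendsto_norm_zero
  have h2 : Gs 2 =O[𝓝 0] fun x => ‖x‖ ^ 2 := by
    refine IsBigO.of_bound C (Eventually.of_forall fun x => ?_)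
    rw [hL 2 le_rfl, Real.norm_of_nonneg (by positivity)]
    simpa [Fin.prod_univ_two, pow_two] using hB fun _ => x
  have h1 : (fun x => G x - Gs 2 x) =O[𝓝 0] fun x => ‖x‖ ^ 2 := by
    refine (by simpa using hO : (fun x => G x - Gs 2 x) =O[𝓝 0]
      fun x => ‖x‖ ^ ((2 : ℝ) + δ)).trans (IsBigO.of_bound 1 ?_)
    filter_upwards [hnorm.eventually (gt_mem_nhds one_pos)] with x hx
    rw [Real.norm_of_nonneg (by positivity), Real.norm_of_nonneg (by positivity), one_mul,
      ← Real.rpow_natCast]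
    exact Real.rpow_le_rpow_of_exponent_ge_of_imp (norm_nonneg x) hx.le
      (by push_cast; linarith) (fun _ h => by linarith)
  have h3 : G =O[𝓝 0] fun x => ‖x‖ ^ 2 := by simpa using h1.add h2
  exact h3.trans_isLittleO (isLittleO_norm_pow_id one_lt_two)

/-! ### The index sets of the nonlinear terms -/

/-- The pairs `(m, (j_1, …, j_m))` with `2 ≤ m ≤ M` and all `j_l < N`. They index the terms of
`∑_{m=2}^M L_m(Y, …, Y)` for `Y = ∑_{j < N} y_j`. -/
def boxIndex (M N : ℕ) : Finset (Σ m : ℕ, Fin m → ℕ) :=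
  (Finset.Icc 2 M).sigma fun _ => Fintype.piFinset fun _ => Finset.range N

theorem mem_boxIndex {M N : ℕ} {q : Σ m : ℕ, Fin m → ℕ} :
    q ∈ boxIndex M N ↔ (2 ≤ q.1 ∧ q.1 ≤ M) ∧ ∀ l, q.2 l < N := by
  simp [boxIndex]

section Index

variable {μ : ℕ → ℝ}

/-- Since at least two positive exponents are added up, every `j_l` in `sumIndex μ k` is `< k`. -/
theorem lt_of_mem_sumIndex (hpos : ∀ k, 0 < μ k) (hmono : StrictMono μ) {k : ℕ}
    {q : Σ m : ℕ, Fin m → ℕ} (hq : q ∈ sumIndex μ k) (l : Fin q.1) : q.2 l < k := by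
  obtain ⟨h2, hs⟩ := hq
  refine hmono.lt_iff_lt.1 ?_
  rw [← hs, ← Finset.add_sum_erase _ _ (Finset.mem_univ l)]
  refine lt_add_of_pos_right _ (Finset.sum_pos (fun i _ => hpos _) ?_)
  rw [← Finset.card_pos, Finset.card_erase_of_mem (Finset.mem_univ l), Finset.card_univ,
    Fintype.card_fin]
  omega

theorem mem_boxIndex_of_mem_sumIndex (hpos : ∀ k, 0 < μ k) (hmono : StrictMono μ) {k M N : ℕ}
    (hkN : k ≤ N) (hM : μ k < (M + 1) * μ 0)
    {q : Σ m : ℕ, Fin m → ℕ} (hq : q ∈ sumIndex μ k) : q ∈ boxIndex M N := by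
  refine mem_boxIndex.2 ⟨⟨hq.1, ?_⟩,
    fun l => (lt_of_mem_sumIndex hpos hmono hq l).trans_le hkN⟩
  have h1 : (q.1 : ℝ) * μ 0 ≤ μ k := by
    rw [← hq.2]
    simpa using Finset.card_nsmul_le_sum Finset.univ (fun l => μ (q.2 l)) (μ 0)
      (fun l _ => hmono.monotone (Nat.zero_le _))
  have h2 : (q.1 : ℝ) < M + 1 := lt_of_mul_lt_mul_right (h1.trans_lt hM) (hpos 0).le
  exact Nat.lt_succ_iff.1 (by exact_mod_cast h2)

theorem sum_mem_range (hadd : ∀ a ∈ Set.range μ, ∀ b ∈ Set.range μ, a + b ∈ Set.range μ)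
    {q : Σ m : ℕ, Fin m → ℕ} (hq : 2 ≤ q.1) : ∑ l, μ (q.2 l) ∈ Set.range μ := by
  refine Finset.sum_induction_nonempty (fun l => μ (q.2 l)) (· ∈ Set.range μ)
    (fun a b ha hb => hadd a ha b hb) ?_ (fun l _ => ⟨_, rfl⟩)
  exact ⟨⟨0, by omega⟩, Finset.mem_univ _⟩

variable {n : ℕ} (L : ∀ m : ℕ, MultilinearMap ℂ (fun _ : Fin m => EuclideanSpace ℂ (Fin n))
  (EuclideanSpace ℂ (Fin n))) (ys : ℕ → ℝ → EuclideanSpace ℂ (Fin n))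

open scoped Classical in
theorem nonlinearTerm_eq_sum_filter (hpos : ∀ k, 0 < μ k) (hmono : StrictMono μ) {k M N : ℕ}
    (hkN : k ≤ N) (hM : μ k < (M + 1) * μ 0) (t : ℝ) :
    nonlinearTerm μ L ys k t =
      ∑ q ∈ boxIndex M N with ∑ l, μ (q.2 l) = μ k, L q.1 fun l => ys (q.2 l) t := by
  have : sumIndex μ k = ((boxIndex M N).filter fun q => ∑ l, μ (q.2 l) = μ k : Finset _) := by
    ext q
    simp only [Finset.coe_filter, Set.mem_ofPred_eq]
    exact ⟨fun h => ⟨mem_boxIndex_of_mem_sumIndex hpos hmono hkN hM h, h.2⟩,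
      fun h => ⟨(mem_boxIndex.1 h.1).1.1, h.2⟩⟩
  rw [nonlinearTerm, this, finsum_mem_coe_finset]

theorem nonlinearTerm_congr (hpos : ∀ k, 0 < μ k) (hmono : StrictMono μ) {k : ℕ}
    {ys zs : ℕ → ℝ → EuclideanSpace ℂ (Fin n)} (h : ∀ j < k, ys j = zs j) :
    nonlinearTerm μ L ys k = nonlinearTerm μ L zs k := by
  funext t
  refine finsum_mem_congr rfl fun q hq => ?_
  congr 1
  funext l
  rw [h _ (lt_of_mem_sumIndex hpos hmono hq l)]

open scoped Classical in
theorem nonlinearTerm_mem_FE (hpos : ∀ k, 0 < μ k) (hmono : StrictMono μ) {k : ℕ}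
    (hys : ∀ j < k, ys j ∈ FE (-μ j) (EuclideanSpace ℂ (Fin n))) :
    nonlinearTerm μ L ys k ∈ FE (-μ k) (EuclideanSpace ℂ (Fin n)) := by
  rw [show nonlinearTerm μ L ys k = fun t => ∑ q ∈ (sumIndex_finite hpos hmono k).toFinset,
    L q.1 fun l => ys (q.2 l) t from funext fun t => finsum_mem_eq_finite_toFinset_sum _ _]
  refine FE.sum_mem _ fun q hq => ?_
  rw [Set.Finite.mem_toFinset] at hq
  have h := FE.multilinear (fun l => hys _ (lt_of_mem_sumIndex hpos hmono hq l)) (L q.1)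
  rwa [Finset.sum_neg_distrib, hq.2] at h

open scoped Classical in
/-- The nonlinear terms up to index `N` collect the terms of `∑_{m=2}^M L_m(Y, …, Y)`,
`Y = ∑_{j < N} y_j`, whose exponent does not exceed `μ N`. Closedness under addition enters here:
every such exponent is one of `μ 0, …, μ N`. -/
theorem sum_nonlinearTerm (hpos : ∀ k, 0 < μ k) (hmono : StrictMono μ)
    (hadd : ∀ a ∈ Set.range μ, ∀ b ∈ Set.range μ, a + b ∈ Set.range μ) {M N : ℕ}
    (hM : μ N < (M + 1) * μ 0) (t : ℝ) :
    ∑ k ∈ Finset.range (N + 1), nonlinearTerm μ L ys k t =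
      ∑ q ∈ boxIndex M N with ∑ l, μ (q.2 l) ≤ μ N, L q.1 fun l => ys (q.2 l) t := by
  have h1 : ((boxIndex M N).filter fun q => ∑ l, μ (q.2 l) ≤ μ N) =
      (Finset.range (N + 1)).biUnion
        fun k => (boxIndex M N).filter fun q => ∑ l, μ (q.2 l) = μ k := by
    ext q
    simp only [Finset.mem_filter, Finset.mem_biUnion, Finset.mem_range]
    constructor
    · rintro ⟨hq, hle⟩
      obtain ⟨k, hk⟩ := sum_mem_range hadd (mem_boxIndex.1 hq).1.1
      exact ⟨k, Nat.lt_succ_of_le (hmono.le_iff_le.1 (hk ▸ hle)), hq, hk.symm⟩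
    · rintro ⟨k, hk, hq, he⟩
      exact ⟨hq, he ▸ hmono.monotone (Nat.lt_succ_iff.1 hk)⟩
  rw [h1, Finset.sum_biUnion]
  · refine Finset.sum_congr rfl fun k hk => ?_
    have hkN := Nat.lt_succ_iff.1 (Finset.mem_range.1 hk)
    exact nonlinearTerm_eq_sum_filter L ys hpos hmono hkN
      ((hmono.monotone hkN).trans_lt hM) t
  · intro k _ k' _ hkk'
    refine Finset.disjoint_filter.2 fun q _ h h' => hkk' (hmono.injective (h.symm.trans h'))

theorem sum_multilinear_eq_sum_boxIndex (M N : ℕ) (t : ℝ) :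
    ∑ m ∈ Finset.Icc 2 M, L m (fun _ => ∑ j ∈ Finset.range N, ys j t) =
      ∑ q ∈ boxIndex M N, L q.1 fun l => ys (q.2 l) t := by
  rw [boxIndex, Finset.sum_sigma]
  exact Finset.sum_congr rfl fun m _ => (L m).map_sum_finset _ _

end Index

/-! ### Construction of the expansion -/

/-- Choice of a sequence by strong recursion: `R k s p` says that `p` is admissible as the term of
index `k` after the terms `s j`, `j < k`. -/
theorem exists_seq_of_forall_extend {X : Type*} [Inhabited X] {R : ℕ → (ℕ → X) → X → Prop}
    (hcongr : ∀ k s s' p, (∀ j < k, s j = s' j) → R k s p → R k s' p)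
    (hstep : ∀ k s, (∀ j < k, R j s (s j)) → ∃ p, R k s p) : ∃ s, ∀ k, R k s (s k) := by
  choose! Φ hΦ using hstep
  let s : ℕ → X := wellFounded_lt.fix
    fun k ih => Φ k fun j => if h : j < k then ih j h else default
  have hs : ∀ k, s k = Φ k fun j => if j < k then s j else default :=
    fun k => wellFounded_lt.fix_eq _ k
  refine ⟨s, fun k => ?_⟩
  induction k using Nat.strong_induction_on with
  | _ k ih =>
  set s' : ℕ → X := fun j => if j < k then s j else default with hs'
  have hss' : ∀ j < k, s j = s' j := fun j hj => by rw [hs']; exact (if_pos hj).symm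
  refine hcongr k s' s _ (fun j hj => (hss' j hj).symm) ?_
  rw [hs k]
  refine hΦ k s' fun j hj => ?_
  rw [← hss' j hj]
  exact hcongr j s s' _ (fun i hi => hss' i (hi.trans hj)) (ih j hj)

section Step

variable {n : ℕ} {G : EuclideanSpace ℂ (Fin n) → EuclideanSpace ℂ (Fin n)}
  {Gs : ℕ → EuclideanSpace ℂ (Fin n) → EuclideanSpace ℂ (Fin n)}
  {L : ∀ m : ℕ, MultilinearMap ℂ (fun _ : Fin m => EuclideanSpace ℂ (Fin n))
    (EuclideanSpace ℂ (Fin n))} {μ : ℕ → ℝ}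
  {y : ℝ → EuclideanSpace ℂ (Fin n)} {ys : ℕ → ℝ → EuclideanSpace ℂ (Fin n)}

/-- If `y` is approximated by `Y = ∑_{k < N} y_k` up to `O(e^{-μ' t})`, then the nonlinear terms up
to index `N` approximate `G(y)` better than `e^{-μ_N t}`. -/
theorem decaysFaster_sub_sum_nonlinearTerm (hG : HasFormalTaylorExpansion G Gs)
    (hL : ArePolarizations Gs L) (hpos : ∀ k, 0 < μ k) (hmono : StrictMono μ)
    (hadd : ∀ a ∈ Set.range μ, ∀ b ∈ Set.range μ, a + b ∈ Set.range μ)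
    (hy0 : Tendsto y atTop (𝓝 0)) {N : ℕ} {α μ' : ℝ} (hα : 0 < α) (hα0 : α < μ 0)
    (hαμ' : μ N < α + μ') (hys : ∀ k < N, ys k ∈ FE (-μ k) (EuclideanSpace ℂ (Fin n)))
    (hyO : y =O[atTop] fun t => Real.exp (-α * t))
    (hwO : (fun t => y t - ∑ k ∈ Finset.range N, ys k t) =O[atTop] fun t => Real.exp (-μ' * t)) :
    DecaysFaster (μ N) fun t => G (y t) - ∑ k ∈ Finset.range (N + 1), nonlinearTerm μ L ys k t := by
  classical
  -- the Taylor polynomial of degree `M` leaves a remainder `O(|y|^{M+δ})`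
  obtain ⟨M, hM2, hM⟩ : ∃ M : ℕ, 2 ≤ M ∧ μ N < M * α := by
    obtain ⟨M, hM⟩ := exists_nat_gt (μ N / α)
    refine ⟨M + 2, by omega, ?_⟩
    rw [div_lt_iff₀ hα] at hM
    push_cast
    nlinarith
  have hM0 : μ N < (M + 1) * μ 0 := by
    have : (M : ℝ) * α ≤ M * μ 0 := by gcongr
    nlinarith [hpos 0]
  have h1 : DecaysFaster (μ N) fun t => G (y t) - ∑ m ∈ Finset.Icc 2 M, L m fun _ => y t := by
    obtain ⟨δ, hδ, hO⟩ := hG.2 M hM2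
    refine ⟨α * (M + δ), by nlinarith, ?_⟩
    have h2 := (hO.comp_tendsto hy0).trans ((hyO.norm_left.rpow (r := M + δ) (by positivity)
      (Eventually.of_forall fun t => (Real.exp_pos _).le)))
    refine h2.congr (fun t => ?_) fun t => ?_
    · simp only [Function.comp_apply]
      congr 1
      exact Finset.sum_congr rfl fun m hm => hL m (Finset.mem_Icc.1 hm).1 _
    · rw [← Real.exp_mul]
      ring_nf
  have hYO : (fun t => ∑ k ∈ Finset.range N, ys k t) =O[atTop] fun t => Real.exp (-α * t) :=
    IsBigO.fun_sum fun k hk => FE.isBigO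
      (neg_lt_neg (hα0.trans_le (hmono.monotone (Nat.zero_le k))))
      (hys k (Finset.mem_range.1 hk))
  have h2 : DecaysFaster (μ N) fun t => ∑ m ∈ Finset.Icc 2 M,
      (L m (fun _ => y t) - L m fun _ => ∑ k ∈ Finset.range N, ys k t) :=
    DecaysFaster.sum _ fun m hm => ⟨α + μ', hαμ',
      isBigO_multilinear_sub (Finset.mem_Icc.1 hm).1 (L m) hα.le hyO hYO hwO⟩
  have h3 : DecaysFaster (μ N) fun t => ∑ q ∈ boxIndex M N with ¬ ∑ l, μ (q.2 l) ≤ μ N,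
      L q.1 fun l => ys (q.2 l) t := by
    refine DecaysFaster.sum _ fun q hq => ?_
    obtain ⟨hq, hlt⟩ := Finset.mem_filter.1 hq
    refine DecaysFaster.of_mem_FE (not_le.1 hlt) ?_
    rw [← Finset.sum_neg_distrib]
    exact FE.multilinear (fun l => hys _ ((mem_boxIndex.1 hq).2 l)) (L q.1)
  refine ((h1.add h2).add h3).congr' (Eventually.of_forall fun t => ?_)
  dsimp only
  rw [sum_nonlinearTerm L ys hpos hmono hadd hM0, Finset.sum_sub_distrib,
    sum_multilinear_eq_sum_boxIndex, ← Finset.sum_filter_add_sum_filter_not (boxIndex M N)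
      (fun q => ∑ l, μ (q.2 l) ≤ μ N)]
  abel

variable {A : Module.End ℂ (EuclideanSpace ℂ (Fin n))}
  {f : ℝ → EuclideanSpace ℂ (Fin n)} {fs : ℕ → ℝ → EuclideanSpace ℂ (Fin n)}

/-- The inductive step: the next term of the expansion of a decaying solution. -/
theorem exists_next_term (hA : ∀ z, A.HasEigenvalue z → z.re ∈ Set.range μ)
    (hG : HasFormalTaylorExpansion G Gs)
    (hL : ArePolarizations Gs L) (hpos : ∀ k, 0 < μ k) (hmono : StrictMono μ)
    (hadd : ∀ a ∈ Set.range μ, ∀ b ∈ Set.range μ, a + b ∈ Set.range μ)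
    (hf : HasExpansion f μ fs) (hy0 : Tendsto y atTop (𝓝 0))
    (hyO : ∀ α < μ 0, y =O[atTop] fun t => Real.exp (-α * t))
    (hy : ∀ᶠ t in atTop, HasDerivAt y (-(A (y t)) + G (y t) + f t) t) {N : ℕ}
    (hys : ∀ k < N, ys k ∈ FE (-μ k) (EuclideanSpace ℂ (Fin n)))
    (hysd : ∀ k < N, ∀ t,
      HasDerivAt (ys k) (-(A (ys k t)) + nonlinearTerm μ L ys k t + fs k t) t)
    {μ' : ℝ} (hμ' : ∀ k < N, μ k < μ') (hμ'N : μ N < μ 0 + μ')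
    (hwO : (fun t => y t - ∑ k ∈ Finset.range N, ys k t) =O[atTop] fun t => Real.exp (-μ' * t)) :
    ∃ p ∈ FE (-μ N) (EuclideanSpace ℂ (Fin n)),
      (∀ t, HasDerivAt p (-(A (p t)) + nonlinearTerm μ L ys N t + fs N t) t) ∧
      DecaysFaster (μ N) fun t => y t - ∑ k ∈ Finset.range N, ys k t - p t := by
  obtain ⟨α, hα, hα0⟩ := exists_between (max_lt (hpos 0) (by linarith : μ N - μ' < μ 0))
  have hGd := decaysFaster_sub_sum_nonlinearTerm hG hL hpos hmono hadd hy0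
    ((le_max_left _ _).trans_lt hα) hα0 (by linarith [(le_max_right _ _).trans_lt hα]) hys
    (hyO α hα0) hwO
  obtain ⟨p, hp, hpd, hpw⟩ := exists_FE_asymptotics _ _ A rfl (μ := μ N) (μ' := μ')
    (fun z hz => by
      obtain ⟨k, hk⟩ := hA z hz
      rw [← hk]
      rcases lt_or_ge k N with h | h
      exacts [Or.inl (hμ' k h), Or.inr (hmono.monotone h)])
    (fun t => y t - ∑ k ∈ Finset.range N, ys k t)
    (fun t => nonlinearTerm μ L ys N t + fs N t) _
    (FE.add_mem (nonlinearTerm_mem_FE L ys hpos hmono hys) (hf.1 N)) (hGd.add (hf.2 N)) hwO (by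
      filter_upwards [hy] with t ht
      refine (ht.sub (HasDerivAt.fun_sum fun k (hk : k ∈ Finset.range N) =>
        hysd k (Finset.mem_range.1 hk) t)).congr_deriv ?_
      rw [map_sub, map_sum, Finset.sum_range_succ, Finset.sum_range_succ, Finset.sum_add_distrib,
        Finset.sum_add_distrib, Finset.sum_neg_distrib]
      abel)
  exact ⟨p, hp, fun t => by simpa only [add_assoc] using hpd t, hpw⟩

theorem exists_expansion (hA : ∀ z, A.HasEigenvalue z → z.re ∈ Set.range μ)
    (hG : HasFormalTaylorExpansion G Gs)
    (hL : ArePolarizations Gs L) (hpos : ∀ k, 0 < μ k) (hmono : StrictMono μ)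
    (hadd : ∀ a ∈ Set.range μ, ∀ b ∈ Set.range μ, a + b ∈ Set.range μ)
    (hf : HasExpansion f μ fs) (hy0 : Tendsto y atTop (𝓝 0))
    (hy : ∀ᶠ t in atTop, HasDerivAt y (-(A (y t)) + G (y t) + f t) t) :
    ∃ ys : ℕ → ℝ → EuclideanSpace ℂ (Fin n), HasExpansion y μ ys ∧
      ∀ k, ∀ t : ℝ,
        HasDerivAt (ys k) (-(A (ys k t)) + nonlinearTerm μ L ys k t + fs k t) t := by
  have hyO : ∀ α < μ 0, y =O[atTop] fun t => Real.exp (-α * t) := by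
    intro α hα
    refine isBigO_exp_of_tendsto_zero (fun z hz => ?_) (hL.isLittleO hG) ?_ hy0 hy
    · obtain ⟨k, hk⟩ := hA z hz
      rw [← hk]
      exact hα.trans_le (hmono.monotone (Nat.zero_le k))
    · obtain ⟨ν, hν, hO⟩ := hf.2 0
      have h1 := (hO.trans (isBigO_exp_neg_of_le (hα.trans hν).le)).add
        (FE.isBigO (neg_lt_neg hα) (hf.1 0))
      simpa using h1
  obtain ⟨ys, hR⟩ := exists_seq_of_forall_extend
    (R := fun k (s : ℕ → ℝ → EuclideanSpace ℂ (Fin n)) p =>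
      p ∈ FE (-μ k) (EuclideanSpace ℂ (Fin n)) ∧
      (∀ t, HasDerivAt p (-(A (p t)) + nonlinearTerm μ L s k t + fs k t) t) ∧
      DecaysFaster (μ k) fun t => y t - ∑ j ∈ Finset.range k, s j t - p t)
    (by
      rintro k s s' p hss' ⟨h1, h2, h3⟩
      refine ⟨h1, fun t => ?_, ?_⟩
      · rw [← nonlinearTerm_congr L hpos hmono hss']
        exact h2 t
      · refine h3.congr' (Eventually.of_forall fun t => ?_)
        dsimp only
        rw [Finset.sum_congr rfl fun j hj => congrFun (hss' j (Finset.mem_range.1 hj)) t])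
    (by
      intro N s hs
      obtain ⟨μ', h1, h2, h3⟩ : ∃ μ', (∀ k < N, μ k < μ') ∧ μ N < μ 0 + μ' ∧
          (fun t => y t - ∑ k ∈ Finset.range N, s k t) =O[atTop]
            fun t => Real.exp (-μ' * t) := by
        cases N with
        | zero =>
          refine ⟨μ 0 / 2, by simp, by linarith [hpos 0], ?_⟩
          simpa using hyO (μ 0 / 2) (half_lt_self (hpos 0))
        | succ k =>
          obtain ⟨-, -, ν, hν, hO⟩ := hs k k.lt_succ_self
          refine ⟨ν, fun j hj => (hmono.monotone (Nat.lt_succ_iff.1 hj)).trans_lt hν, ?_, ?_⟩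
          · -- `μ 0 + μ k` is an exponent beyond `μ k`, so it is at least `μ (k + 1)`
            obtain ⟨i, hi⟩ := hadd _ ⟨0, rfl⟩ _ ⟨k, rfl⟩
            have hki : k < i := hmono.lt_iff_lt.1 (by linarith [hpos 0])
            have := hmono.monotone (Nat.succ_le_of_lt hki)
            rw [hi] at this
            linarith
          · simpa only [Finset.sum_range_succ, sub_sub] using hO
      exact exists_next_term hA hG hL hpos hmono hadd hf hy0 hyO hy (fun k hk => (hs k hk).1)
        (fun k hk => (hs k hk).2.1) h1 h2 h3)
  refine ⟨ys, ⟨fun k => (hR k).1, fun N => ?_⟩, fun k => (hR k).2.1⟩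
  obtain ⟨ν, hν, hO⟩ := (hR N).2.2
  exact ⟨ν, hν, by simpa only [Finset.sum_range_succ, sub_sub] using hO⟩

end Step

end ExpExpansion

theorem theorem7p5 (n : ℕ) (hn : 1 ≤ n)
    -- all eigenvalues of `A` have positive real parts
    (A : Matrix (Fin n) (Fin n) ℂ) (hA : ∀ z ∈ spectrum ℂ A, 0 < z.re)
    -- the nonlinearity `G` with `G(x) ∼ ∑_{m ≥ 2} G_m(x)`
    (G : EuclideanSpace ℂ (Fin n) → EuclideanSpace ℂ (Fin n)) (hGlip : LocallyLipschitz G)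
    (Gs : ℕ → EuclideanSpace ℂ (Fin n) → EuclideanSpace ℂ (Fin n))
    (hG : ExpExpansion.HasFormalTaylorExpansion G Gs)
    -- the exponents; `μ k` is the `(k+1)`-st exponent
    (μ : ℕ → ℝ) (hμpos : ∀ k, 0 < μ k) (hμmono : StrictMono μ) (hμdiv : Tendsto μ atTop atTop)
    (hμadd : ∀ a ∈ Set.range μ, ∀ b ∈ Set.range μ, a + b ∈ Set.range μ)
    (hμspec : Complex.re '' spectrum ℂ A ⊆ Set.range μ)
    -- the forcing function with `f ∼ ∑ f_k`, `f_k ∈ 𝓕_E(-μ_k, ℂⁿ)`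
    (f : ℝ → EuclideanSpace ℂ (Fin n)) (T_f : ℝ) (hT_f : 0 ≤ T_f)
    (hfcont : ContinuousOn f (Set.Ici T_f))
    (fs : ℕ → ℝ → EuclideanSpace ℂ (Fin n)) (hf : ExpExpansion.HasExpansion f μ fs)
    -- a decaying solution `y`
    (y : ℝ → EuclideanSpace ℂ (Fin n)) (T₀ : ℝ) (hT₀ : 0 ≤ T₀)
    (hyC1 : ContDiffOn ℝ 1 y (Set.Ioi T₀))
    (hysol : ∀ t, T₀ < t →
      HasDerivAt y (-(Matrix.toEuclideanLin A (y t)) + G (y t) + f t) t)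
    (hylim : Tendsto y atTop (𝓝 0)) :
    (∃ L, ExpExpansion.ArePolarizations Gs L) ∧
    ∀ L, ExpExpansion.ArePolarizations Gs L →
      ∃ ys : ℕ → ℝ → EuclideanSpace ℂ (Fin n),
        (∀ k, ys k ∈ ExpExpansion.FE (-μ k) (EuclideanSpace ℂ (Fin n))) ∧
        ExpExpansion.HasExpansion y μ ys ∧
        ∀ k, ∀ t : ℝ,
          HasDerivAt (ys k)
            (-(Matrix.toEuclideanLin A (ys k t)) + ExpExpansion.nonlinearTerm μ L ys k t
              + fs k t) t := by
  -- matrix eigenvalues are eigenvalues of the associated operator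
  have hA' : ∀ z, Module.End.HasEigenvalue (Matrix.toEuclideanLin A) z →
      z.re ∈ Set.range μ := by
    intro z hz
    refine hμspec ⟨z, ?_, rfl⟩
    rw [← Matrix.spectrum_toLpLin 2]
    exact Module.End.hasEigenvalue_iff_mem_spectrum.1 hz
  refine ⟨ExpExpansion.exists_polarizations hG, fun L hL => ?_⟩
  obtain ⟨ys, h1, h2⟩ := ExpExpansion.exists_expansion hA' hG hL hμpos hμmono hμadd hf hylim
    ((eventually_gt_atTop T₀).mono fun t ht => hysol t ht)
  exact ⟨ys, h1.1, h1, h2⟩
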